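/- Let $\mathtt M$ be a real symmetric positive definite $2\times2$ matrix, $\mathtt K$ a real diagonal positive definite $2\times 2$ matrix and $M_3,N_3\in\mathbb R$. Let $0<\omega_-<\omega_+$ with $\omega_+\neq 3\omega_-$, and let $\Phi=\begin{pmatrix}\phi_1^-&\phi_1^+\\ \phi_2^-&\phi_2^+\end{pmatrix}$ be a real matrix such that $\Phi^T\mathtt M\Phi=\mathrm{Id}$ and $\Phi^T\mathtt K\Phi=\mathrm{diag}(\omega_-^2,\omega_+^2)$. Put $\omega=(\omega_-,\omega_+)$ and $$f(q)=\tfrac14M_3(\phi_1^-q_1+\phi_1^+q_2)^4+\tfrac14N_3(\phi_2^-q_1+\phi_2^+q_2)^4 .$$ On $\mathbb C^2$, with the norm $\|z\|=\max\{|z_1|,|z_2|\}$, consider the Hamiltonian $$\mathtt H=\omega_-|z_1|^2+\omega_+|z_2|^2+\mathtt G,\qquad \mathtt G=f\Big(\frac{z_1+\bar z_1}{\sqrt{2\omega_-}},\frac{z_2+\bar z_2}{\sqrt{2\omega_+}}\Big)=\sum_{|\alpha+\beta|=4}G_{\alpha,\beta}z^\alpha\bar z^\beta .$$ Hamilton's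 equations of a Hamiltonian $F$ are $\dot z_j=-\mathrm i\,\partial_{\bar z_j}F$. Let $S=\sum_{|\alpha+\beta|=4}S_{\alpha,\beta}z^\alpha\bar z^\beta$ with $S_{\alpha,\beta}=\mathrm i\,G_{\alpha,\beta}/(\omega\cdot(\alpha-\beta))$ if $\alpha\ne\beta$ and $S_{\alpha,\alpha}=0$, let $\Phi_S^1$ be the time-one map of the Hamiltonian flow of $S$, and let $\mathrm H=\mathtt H\circ\Phi^1_S$ be the (nonresonant, fourth order) Birkhoff Normal Form Hamiltonian. Put $$\bar{\mathtt H}_4=\sum_{|\alpha|=2}G_{\alpha,\alpha}|z^{\alpha}|^2,\qquad \mathcal H_4(I)=G_{(2,0),(2,0)}I_1^2+G_{(1,1),(1,1)}I_1I_2+G_{(0,2),(0,2)}I_2^2,\qquad \hat{\mathtt G}=\mathtt G-\bar{\mathtt H}_4 .$$ For a quartic polynomial $P=\sum_{|\alpha+\beta|=4} P_{\alpha,\beta}z^\alpha\bar z^\beta$ put $P^{(j)}=\sum_{|\alpha+\beta|=4}\alpha_j|P_{\alpha,\beta}|$, $j=1,2$, and let $$S_*=\max\{S^{(1)},S^{(2)}\},\qquad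 R_\dag=\sum_{j=1,2}S^{(j)}\big(2\bar{\mathtt H}_4^{(j)}+\hat{\mathtt G}^{(j)}\big),\qquad R_*=(9/2)^6R_\dag .$$ Let $\mathbf A=\partial_I^2\mathcal H_4(0)$ be the Hessian matrix of $\mathcal H_4$ at $I=0$ and $\|\mathbf A\|$ its operator norm with respect to the maximum norm on $\mathbb R^2$. Let $z(0)\in\mathbb C^2$, $\epsilon=\|z(0)\|>0$, and let $\xi>0$ (so $\xi\le\frac12$) satisfy $2\xi\epsilon=\min\{|z_1(0)|,|z_2(0)|\}$. Let $t_*=\dfrac{3\xi^2}{2R_*}$ and assume $$\epsilon\le\frac{2}{9\sqrt{3S_*}} ,$$ where, in the linear case $M_3=N_3=0$ (in which $S_*=R_*=0$), both $t_*$ and the right-hand side are read as $+\infty$. Then: 1. $\Phi^1_S$ is well defined and $\mathrm H$ is (real) differentiable on $\{\|w\|<3\epsilon\}$. 2. Hamilton's equations of $\mathrm H$ with initial datum $z(0)$ have a solution on the whole set of times $|t|\le t_*\epsilon^{-4}$. 3. Set $I_{0,j}=|z_j(0)|^2/\epsilon^2$ for $j=1,2$ and $$z^{(1)}_j(T_0,T_2)=\epsilon^{-1}z_j(0)\,e^{-\mathrm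 i(\omega_jT_0+(\mathbf AI_0)_jT_2)}\quad(\omega_1=\omega_-,\ \omega_2=\omega_+),\qquad z^{(3)}\equiv0 .$$ Every solution $z(t)$ of Hamilton's equations of $\mathrm H$ with initial datum $z(0)$, on any interval of times containing $0$ and contained in $\{|t|\le t_*\epsilon^{-4}\}$, has the form $$z(t)=\epsilon z^{(1)}(t,\epsilon^2t)+\epsilon^3z^{(3)}(t,\epsilon^2t)+\epsilon^5\tilde z(t)$$ with, for all $t$ in that interval, $$\|z(t)\|\le\frac{7}{2\sqrt2}\,\epsilon,\qquad \|\tilde z(t)\|\le\big(\epsilon^2\|\mathbf A\||t|+\xi^{-1}\big)R_*|t| .$$ -/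

import Mathlib

namespace MetaBNF

/-- Phase space `ℂ²`. The norm of `Fin 2 → ℂ` is the maximum norm `max {|z₁|, |z₂|}`;
index `0` is the first component (the acoustic mode `-`), index `1` the second one (the optical
mode `+`). -/
abbrev Phase : Type := Fin 2 → ℂ

/-! ### Hamiltonian formalism in complex coordinates -/

/-- Wirtinger derivative `∂F/∂z̄_j = (∂F/∂x_j + i ∂F/∂y_j) / 2`, where `z_j = x_j + i y_j`. -/
noncomputable def dzbar (F : Phase → ℂ) (z : Phase) (j : Fin 2) : ℂ :=
  (1 / 2) * (fderiv ℝ F z (Pi.single j 1) + Complex.I * fderiv ℝ F z (Pi.single j Complex.I))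

/-- Hamiltonian vector field of `F`: Hamilton's equations are `ż_j = -i ∂F/∂z̄_j`. -/
noncomputable def hamField (F : Phase → ℂ) (z : Phase) : Phase :=
  fun j => -Complex.I * dzbar F z j

/-- `z` solves Hamilton's equations of `F` on the set of times `J`. -/
def IsSolutionOn (F : Phase → ℂ) (J : Set ℝ) (z : ℝ → Phase) : Prop :=
  ∀ t ∈ J, HasDerivWithinAt z (hamField F (z t)) J t

/-- The initial data whose Hamiltonian flow generated by `S` exists for all times in `[0, 1]`. -/
def flowDomain (S : Phase → ℂ) : Set Phase :=
  {w | ∃ u : ℝ → Phase, u 0 = w ∧ IsSolutionOn S (Set.Icc 0 1) u}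

open Classical in
/-- Time-one map of the Hamiltonian flow generated by `S`. For the polynomial generating functions
used here the vector field is locally Lipschitz, so the arc `u` is unique on `[0, 1]`.
Outside `flowDomain S` the value is irrelevant. -/
noncomputable def timeOneMap (S : Phase → ℂ) (w : Phase) : Phase :=
  if h : ∃ u : ℝ → Phase, u 0 = w ∧ IsSolutionOn S (Set.Icc 0 1) u then h.choose 1 else w

/-! ### The system in modal coordinates -/

/-- The parameters of the system in modal coordinates: the linear frequencies `ω = (ω₋, ω₊)`, the
modal matrix `Φ = ((φ₁⁻, φ₁⁺), (φ₂⁻, φ₂⁺))` and the coefficients of the cubic springs. -/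
structure Params where
  ω : Fin 2 → ℝ
  Φ : Matrix (Fin 2) (Fin 2) ℝ
  M₃ : ℝ
  N₃ : ℝ

/-- A pair of multi-indices `(α, β) ∈ ℕ² × ℕ²`. -/
abbrev BiIndex : Type := (Fin 2 → ℕ) × (Fin 2 → ℕ)

/-- The pairs of multi-indices with `|α + β| = 4`. -/
def quartic : Finset BiIndex :=
  ((Fintype.piFinset fun _ : Fin 2 => Finset.range 5) ×ˢ
    (Fintype.piFinset fun _ : Fin 2 => Finset.range 5)).filter
      fun m => ∑ j, (m.1 j + m.2 j) = 4

/-- The quartic polynomial `∑_{|α+β|=4} c_{α,β} z^α z̄^β`. -/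
noncomputable def quarticPoly (c : BiIndex → ℂ) (z : Phase) : ℂ :=
  ∑ m ∈ quartic, c m * ∏ j, (z j ^ m.1 j * (starRingEnd ℂ) (z j) ^ m.2 j)

/-- For a quartic polynomial with coefficients `c`: the number
`P^{(j)} = ∑_{|α+β|=4} α_j |c_{α,β}|`. -/
noncomputable def weight (c : BiIndex → ℂ) (j : Fin 2) : ℝ :=
  ∑ m ∈ quartic, (m.1 j : ℝ) * ‖c m‖

namespace Params

variable (P : Params)

/-- The quartic potential
`f(q) = M₃ (φ₁⁻ q₁ + φ₁⁺ q₂)⁴ / 4 + N₃ (φ₂⁻ q₁ + φ₂⁺ q₂)⁴ / 4`. -/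
noncomputable def potential (q₁ q₂ : ℝ) : ℝ :=
  (1 / 4) * P.M₃ * (P.Φ 0 0 * q₁ + P.Φ 0 1 * q₂) ^ 4 +
    (1 / 4) * P.N₃ * (P.Φ 1 0 * q₁ + P.Φ 1 1 * q₂) ^ 4

/-- The Hamiltonian
`ω₋ |z₁|² + ω₊ |z₂|² + f((z₁ + z̄₁)/√(2ω₋), (z₂ + z̄₂)/√(2ω₊))`. -/
noncomputable def hamiltonian (z : Phase) : ℂ :=
  ((P.ω 0 * ‖z 0‖ ^ 2 + P.ω 1 * ‖z 1‖ ^ 2 +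
    P.potential (2 * (z 0).re / √(2 * P.ω 0)) (2 * (z 1).re / √(2 * P.ω 1)) : ℝ) : ℂ)

/-- The coefficients `f_{i,j}` of `f(q) = ∑_{i+j=4} f_{i,j} q₁^i q₂^j`. -/
noncomputable def fCoeff (i j : ℕ) : ℝ :=
  6 / ((i.factorial : ℝ) * (j.factorial : ℝ)) *
    (P.Φ 0 0 ^ i * P.Φ 0 1 ^ j * P.M₃ + P.Φ 1 0 ^ i * P.Φ 1 1 ^ j * P.N₃)

/-- The coefficients `G_{α,β}` of the quartic part of the Hamiltonian, in the monomials
`z^α z̄^β` with `|α + β| = 4`. -/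
noncomputable def gCoeff (m : BiIndex) : ℝ :=
  P.fCoeff (m.1 0 + m.2 0) (m.1 1 + m.2 1) /
      (4 * √(P.ω 0) ^ (m.1 0 + m.2 0) * √(P.ω 1) ^ (m.1 1 + m.2 1)) *
    (((m.1 0 + m.2 0).factorial : ℝ) / ((m.1 0).factorial * (m.2 0).factorial)) *
    (((m.1 1 + m.2 1).factorial : ℝ) / ((m.1 1).factorial * (m.2 1).factorial))

/-- The divisor `ω · (α - β)`. -/
noncomputable def divisor (m : BiIndex) : ℝ :=
  ∑ j, P.ω j * ((m.1 j : ℝ) - (m.2 j : ℝ))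

/-- The coefficients of the generating function: `i G_{α,β} / (ω · (α - β))` for `α ≠ β`, and `0`
otherwise. -/
noncomputable def sCoeff (m : BiIndex) : ℂ :=
  if m.1 = m.2 then 0 else Complex.I * ((P.gCoeff m / P.divisor m : ℝ) : ℂ)

/-- The generating function `S`. -/
noncomputable def generator : Phase → ℂ := quarticPoly P.sCoeff

/-- The Birkhoff Normal Form Hamiltonian: the original Hamiltonian composed with the time-one map
of the flow generated by `S`. -/
noncomputable def bnf (w : Phase) : ℂ := P.hamiltonian (timeOneMap P.generator w)

/-- Coefficients of the diagonal (integrable) quartic part `H̄₄`. -/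
noncomputable def h4Coeff (m : BiIndex) : ℂ := if m.1 = m.2 then (P.gCoeff m : ℂ) else 0

/-- Coefficients of the off-diagonal quartic part `G - H̄₄`. -/
noncomputable def gHatCoeff (m : BiIndex) : ℂ := (P.gCoeff m : ℂ) - P.h4Coeff m

/-- `S_* = max {S^{(1)}, S^{(2)}}`. -/
noncomputable def Sstar : ℝ := max (weight P.sCoeff 0) (weight P.sCoeff 1)

/-- `R_† = ∑_j S^{(j)} (2 H̄₄^{(j)} + Ĝ^{(j)})`. -/
noncomputable def Rdagger : ℝ :=
  ∑ j, weight P.sCoeff j * (2 * weight P.h4Coeff j + weight P.gHatCoeff j)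

/-- `R_* = (9/2)⁶ R_†`. -/
noncomputable def Rstar : ℝ := (9 / 2) ^ 6 * P.Rdagger

/-- The amplitude threshold `2 / (9 √(3 S_*))`, which is `∞` if `S_* = 0`. -/
noncomputable def threshold : ENNReal := 2 / ENNReal.ofReal (9 * √(3 * P.Sstar))

/-- `t_* = 3 ξ² / (2 R_*)`, which is `∞` if `R_* = 0` (and `ξ > 0`). -/
noncomputable def tStar (ξ : ℝ) : ENNReal :=
  ENNReal.ofReal (3 * ξ ^ 2) / ENNReal.ofReal (2 * P.Rstar)

/-- The times with `|t| ≤ t_* ε⁻⁴`. -/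
def timeWindow (ξ ε : ℝ) : Set ℝ :=
  {t | ENNReal.ofReal |t| ≤ P.tStar ξ / ENNReal.ofReal (ε ^ 4)}

/-- `H̄₄` as a function of the actions `I_j = |z_j|²`:
`G_{(2,0),(2,0)} I₁² + G_{(1,1),(1,1)} I₁ I₂ + G_{(0,2),(0,2)} I₂²`. -/
noncomputable def h4Action (I : Fin 2 → ℝ) : ℝ :=
  P.gCoeff (![2, 0], ![2, 0]) * I 0 ^ 2 + P.gCoeff (![1, 1], ![1, 1]) * (I 0 * I 1) +
    P.gCoeff (![0, 2], ![0, 2]) * I 1 ^ 2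

/-- The matrix `A`: the Hessian of `h4Action` at `I = 0`. -/
noncomputable def hessian : Matrix (Fin 2) (Fin 2) ℝ :=
  Matrix.of fun i j =>
    fderiv ℝ (fun I : Fin 2 → ℝ => fderiv ℝ P.h4Action I (Pi.single j 1)) 0 (Pi.single i 1)

/-- Operator norm of `A` with respect to the maximum norm on `ℝ²`. -/
noncomputable def hessianNorm : ℝ := ‖LinearMap.toContinuousLinearMap (Matrix.toLin' P.hessian)‖

end Params

end MetaBNF

/-! The generator `S` solves the homological equation: differentiating the quadratic part along the
field of `S` gives `-Ĝ` (`homological_equation`), because every monomial is an eigenvector of the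
quadratic part with eigenvalue proportional to `ω · (α - β)`, and off the diagonal this divisor can
vanish only if `ω₊ = 3 ω₋`. Along an orbit `u` of `S` the function `H₂ + H̄₄ + s Ĝ` therefore joins
the integrable part at `u 0` to the full Hamiltonian at `u 1`, and its derivative contains only
terms of degree six. So the normal form remainder is the integral over `[0, 1]` of sextic
polynomials along `u`. Comparing two orbits of `S` gives a Lipschitz constant of the remainder
(`norm_remainder_sub_le`), hence a bound `D` of order `R_* ε⁵` for its gradient
(`norm_dzbar_bnf_sub_le`), without series expansions or Cauchy estimates. Differentiability of the
normal form comes from smoothness of the time-one map, obtained from the inverse function theorem on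
curves (`contDiffAt_timeOneMap`).

The integrable part only rotates each coordinate, with frequency `ω + A I`. Actions thus drift at
rate at most `2 r D` in the ball of radius `r` (`abs_normSq_sub_le`); on the time window this is too
little to leave the ball of radius `7/5 ε` (`norm_lt_of_bnf`). In the frame rotating with the
initial frequencies, the remaining velocity is the detuning caused by the drift plus the remainder;
integrating it gives the error, quadratic plus linear in `t` (`norm_sub_exp_le`). The leading term
is the exact integrable motion, so no cubic corrector is needed. For existence, the field is cut off
to a bounded Lipschitz one, whose global orbit never reaches the region where it was changed. -/

namespace MetaBNF

open ComplexConjugate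

/-! ### Wirtinger calculus -/

/-- The real linear form `v ↦ ∑ j, p j * v j + q j * conj (v j)`. -/
noncomputable def wirtinger (p q : Phase) : Phase →L[ℝ] ℂ :=
  ∑ j, (p j • ContinuousLinearMap.proj (R := ℝ) (φ := fun _ : Fin 2 => ℂ) j +
    q j • (Complex.conjCLE : ℂ →L[ℝ] ℂ).comp
      (ContinuousLinearMap.proj (R := ℝ) (φ := fun _ : Fin 2 => ℂ) j))

theorem wirtinger_apply (p q v : Phase) :
    wirtinger p q v = ∑ j, (p j * v j + q j * conj (v j)) := by
  simp [wirtinger, Fin.sum_univ_two]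

theorem dzbar_of_hasFDerivAt {F : Phase → ℂ} {p q z : Phase}
    (h : HasFDerivAt F (wirtinger p q) z) (j : Fin 2) : dzbar F z j = q j := by
  unfold dzbar
  rw [h.fderiv, wirtinger_apply, wirtinger_apply]
  fin_cases j <;> simp [Fin.sum_univ_two] <;> ring_nf <;> simp [Complex.I_sq] <;> ring

theorem hasFDerivAt_coord (j : Fin 2) (z : Phase) :
    HasFDerivAt (fun z : Phase => z j) (wirtinger (Pi.single j 1) 0) z := by
  have h := (ContinuousLinearMap.proj (R := ℝ) (φ := fun _ : Fin 2 => ℂ) j).hasFDerivAt (x := z)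
  convert! h using 1
  ext v
  rw [wirtinger_apply]
  fin_cases j <;> simp [Fin.sum_univ_two]

theorem hasFDerivAt_conj_coord (j : Fin 2) (z : Phase) :
    HasFDerivAt (fun z : Phase => conj (z j)) (wirtinger 0 (Pi.single j 1)) z := by
  have h := ((Complex.conjCLE : ℂ →L[ℝ] ℂ).comp
    (ContinuousLinearMap.proj (R := ℝ) (φ := fun _ : Fin 2 => ℂ) j)).hasFDerivAt (x := z)
  convert! h using 1
  ext v
  rw [wirtinger_apply]
  fin_cases j <;> simp [Fin.sum_univ_two]

theorem hasFDerivAt_wirtinger_mul {F G : Phase → ℂ} {p q p' q' z : Phase}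
    (hF : HasFDerivAt F (wirtinger p q) z) (hG : HasFDerivAt G (wirtinger p' q') z) :
    HasFDerivAt (fun z => F z * G z)
      (wirtinger (F z • p' + G z • p) (F z • q' + G z • q)) z := by
  convert! hF.mul hG using 1
  ext v
  simp only [wirtinger_apply, Fin.sum_univ_two, add_apply,
    smul_apply, Pi.add_apply, Pi.smul_apply, smul_eq_mul]
  ring

theorem hasFDerivAt_wirtinger_pow {F : Phase → ℂ} {p q z : Phase}
    (hF : HasFDerivAt F (wirtinger p q) z) (n : ℕ) :
    HasFDerivAt (fun z => F z ^ n)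
      (wirtinger ((n * F z ^ (n - 1)) • p) ((n * F z ^ (n - 1)) • q)) z := by
  convert! hF.pow n using 1
  ext v
  simp only [wirtinger_apply, Fin.sum_univ_two,
    smul_apply, Pi.smul_apply, smul_eq_mul, nsmul_eq_mul]
  ring

/-! ### Monomials -/

/-- The monomial `z^α z̄^β`. -/
noncomputable def mono (m : BiIndex) (z : Phase) : ℂ :=
  ∏ j, (z j ^ m.1 j * conj (z j) ^ m.2 j)

/-- The degree `|α + β|`. -/
def degree (m : BiIndex) : ℕ := ∑ j, (m.1 j + m.2 j)

/-- `∂/∂z_j` of a monomial. -/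
noncomputable def dzMono (m : BiIndex) (j : Fin 2) (z : Phase) : ℂ :=
  m.1 j * mono (m.1 - Pi.single j 1, m.2) z

/-- `∂/∂z̄_j` of a monomial. -/
noncomputable def dbMono (m : BiIndex) (j : Fin 2) (z : Phase) : ℂ :=
  m.2 j * mono (m.1, m.2 - Pi.single j 1) z

theorem hasFDerivAt_mono (m : BiIndex) (z : Phase) :
    HasFDerivAt (mono m) (wirtinger (fun j => dzMono m j z) (fun j => dbMono m j z)) z := by
  have key : ∀ j : Fin 2, HasFDerivAt (fun z : Phase => z j ^ m.1 j * conj (z j) ^ m.2 j) _ z :=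
    fun j => hasFDerivAt_wirtinger_mul
      (hasFDerivAt_wirtinger_pow (hasFDerivAt_coord j z) (m.1 j))
      (hasFDerivAt_wirtinger_pow (hasFDerivAt_conj_coord j z) (m.2 j))
  have h := hasFDerivAt_wirtinger_mul (key 0) (key 1)
  have e : mono m = fun z => (z 0 ^ m.1 0 * conj (z 0) ^ m.2 0) *
      (z 1 ^ m.1 1 * conj (z 1) ^ m.2 1) := by
    funext z
    simp [mono, Fin.prod_univ_two]
  rw [e]
  convert! h using 2
  · funext j
    fin_cases j <;> simp [dzMono, mono, Fin.prod_univ_two] <;> ring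
  · funext j
    fin_cases j <;> simp [dbMono, mono, Fin.prod_univ_two] <;> ring

theorem dzMono_mul (m : BiIndex) (j : Fin 2) (z : Phase) :
    z j * dzMono m j z = m.1 j * mono m z := by
  unfold dzMono mono
  -- The truncated exponent `m.1 j - 1` is harmless at `m.1 j = 0`: the factor `m.1 j` then
  -- vanishes.
  rcases Nat.eq_zero_or_pos (m.1 j) with h | h
  · simp [h]
  · obtain ⟨n, hn⟩ := Nat.exists_eq_succ_of_ne_zero h.ne'
    fin_cases j <;> simp [Fin.prod_univ_two] at hn ⊢ <;> rw [hn] <;> simp <;> ring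

theorem dbMono_mul (m : BiIndex) (j : Fin 2) (z : Phase) :
    conj (z j) * dbMono m j z = m.2 j * mono m z := by
  unfold dbMono mono
  rcases Nat.eq_zero_or_pos (m.2 j) with h | h
  · simp [h]
  · obtain ⟨n, hn⟩ := Nat.exists_eq_succ_of_ne_zero h.ne'
    fin_cases j <;> simp [Fin.prod_univ_two] at hn ⊢ <;> rw [hn] <;> simp <;> ring

theorem mono_swap (m : BiIndex) (z : Phase) : mono m.swap z = conj (mono m z) := by
  simp [mono, Fin.prod_univ_two]
  ring

theorem dzMono_swap (m : BiIndex) (j : Fin 2) (z : Phase) :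
    dzMono m.swap j z = conj (dbMono m j z) := by
  have h := mono_swap (m.1, m.2 - Pi.single j 1) z
  simp only [Prod.swap_prod_mk] at h
  simp [dzMono, dbMono, h]

/-! ### Bounds for monomials -/

/-- A function bounded by `r ^ n` and Lipschitz with constant `n r ^ (n-1)` on each ball `‖z‖ ≤ r`,
as a monomial of degree `n` is. -/
def MonomialBound (n : ℕ) (F : Phase → ℂ) : Prop :=
  ∀ (r : ℝ) (z z' : Phase), ‖z‖ ≤ r → ‖z'‖ ≤ r →
    ‖F z‖ ≤ r ^ n ∧ ‖F z - F z'‖ ≤ n * r ^ (n - 1) * ‖z - z'‖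

/-- A discrete Leibniz rule, which makes the bound pass from coordinates to monomials. -/
theorem MonomialBound.mul {n k : ℕ} {F G : Phase → ℂ} (hF : MonomialBound n F)
    (hG : MonomialBound k G) : MonomialBound (n + k) (fun z => F z * G z) := by
  intro r z z' hz hz'
  have hr : 0 ≤ r := (norm_nonneg z).trans hz
  obtain ⟨h1, h2⟩ := hF r z z' hz hz'
  obtain ⟨h3, h4⟩ := hG r z z' hz hz'
  have h5 := (hG r z' z hz' hz).1
  refine ⟨?_, ?_⟩
  · rw [norm_mul, pow_add]
    gcongr
  · have e : F z * G z - F z' * G z' = F z * (G z - G z') + (F z - F z') * G z' := by ring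
    rw [e]
    have hn : (n : ℝ) * r ^ (n - 1) * r ^ k = n * r ^ (n + k - 1) := by
      rcases n with _ | n
      · simp
      · rw [mul_assoc, ← pow_add]; congr 2; omega
    have hk : (k : ℝ) * r ^ n * r ^ (k - 1) = k * r ^ (n + k - 1) := by
      rcases k with _ | k
      · simp
      · rw [mul_assoc, ← pow_add]; congr 2
    calc ‖F z * (G z - G z') + (F z - F z') * G z'‖
        ≤ ‖F z‖ * ‖G z - G z'‖ + ‖F z - F z'‖ * ‖G z'‖ := by
          refine (norm_add_le _ _).trans ?_
          rw [norm_mul, norm_mul]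
      _ ≤ r ^ n * (k * r ^ (k - 1) * ‖z - z'‖) + n * r ^ (n - 1) * ‖z - z'‖ * r ^ k := by
          gcongr
      _ = (n * r ^ (n - 1) * r ^ k + k * r ^ n * r ^ (k - 1)) * ‖z - z'‖ := by ring
      _ = _ := by rw [hn, hk]; push_cast; ring

theorem monomialBound_one : MonomialBound 0 (fun _ => 1) := by
  intro r z z' _ _
  simp

theorem MonomialBound.pow {F : Phase → ℂ} (hF : MonomialBound 1 F) (n : ℕ) :
    MonomialBound n (fun z => F z ^ n) := by
  induction n with
  | zero => simpa using monomialBound_one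
  | succ n ih => simpa [pow_succ] using ih.mul hF

theorem monomialBound_coord (j : Fin 2) : MonomialBound 1 (fun z => z j) := by
  intro r z z' hz _
  refine ⟨by simpa using (norm_le_pi_norm z j).trans hz, ?_⟩
  simpa using norm_le_pi_norm (z - z') j

theorem monomialBound_conj_coord (j : Fin 2) : MonomialBound 1 (fun z => conj (z j)) := by
  intro r z z' hz _
  refine ⟨by simpa using (norm_le_pi_norm z j).trans hz, ?_⟩
  rw [← map_sub, RCLike.norm_conj]
  simpa using norm_le_pi_norm (z - z') j

theorem monomialBound_mono (m : BiIndex) : MonomialBound (degree m) (mono m) := by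
  have key := fun j : Fin 2 => ((monomialBound_coord j).pow (m.1 j)).mul
    ((monomialBound_conj_coord j).pow (m.2 j))
  have h := (key 0).mul (key 1)
  have e : mono m = fun z => (z 0 ^ m.1 0 * conj (z 0) ^ m.2 0) *
      (z 1 ^ m.1 1 * conj (z 1) ^ m.2 1) := by
    funext z
    simp [mono, Fin.prod_univ_two]
  rw [e, degree, Fin.sum_univ_two]
  exact h

/-! ### Quartic polynomials -/

theorem mem_quartic {m : BiIndex} : m ∈ quartic ↔ degree m = 4 := by
  simp only [quartic, degree, Finset.mem_filter, Finset.mem_product, Fintype.mem_piFinset,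
    Finset.mem_range, Fin.forall_fin_two, Fin.sum_univ_two]
  omega

theorem swap_mem_quartic {m : BiIndex} : m.swap ∈ quartic ↔ m ∈ quartic := by
  simp only [mem_quartic, degree, Prod.fst_swap, Prod.snd_swap, add_comm]

theorem sum_quartic_swap {M : Type*} [AddCommMonoid M] (f : BiIndex → M) :
    ∑ m ∈ quartic, f m.swap = ∑ m ∈ quartic, f m :=
  Finset.sum_nbij' Prod.swap Prod.swap (fun _ h => swap_mem_quartic.2 h)
    (fun _ h => swap_mem_quartic.2 h) (fun _ _ => Prod.swap_swap _) (fun _ _ => Prod.swap_swap _)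
    (fun _ _ => rfl)

theorem quarticPoly_eq (c : BiIndex → ℂ) (z : Phase) :
    quarticPoly c z = ∑ m ∈ quartic, c m * mono m z := rfl

/-- `∂/∂z_j` of a quartic polynomial. -/
noncomputable def dzPoly (c : BiIndex → ℂ) (j : Fin 2) (z : Phase) : ℂ :=
  ∑ m ∈ quartic, c m * dzMono m j z

/-- `∂/∂z̄_j` of a quartic polynomial. -/
noncomputable def dbPoly (c : BiIndex → ℂ) (j : Fin 2) (z : Phase) : ℂ :=
  ∑ m ∈ quartic, c m * dbMono m j z

theorem hasFDerivAt_quarticPoly (c : BiIndex → ℂ) (z : Phase) :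
    HasFDerivAt (quarticPoly c)
      (wirtinger (fun j => dzPoly c j z) (fun j => dbPoly c j z)) z := by
  have h := HasFDerivAt.fun_sum (u := quartic) fun m _ => (hasFDerivAt_mono m z).const_mul (c m)
  convert! h using 1
  ext v
  simp only [sum_apply, smul_apply, wirtinger_apply,
    dzPoly, dbPoly, Fin.sum_univ_two, Finset.sum_mul, smul_eq_mul]
  simp only [← Finset.sum_add_distrib]
  refine Finset.sum_congr rfl fun m _ => ?_
  ring

theorem dzbar_quarticPoly (c : BiIndex → ℂ) (z : Phase) (j : Fin 2) :
    dzbar (quarticPoly c) z j = dbPoly c j z :=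
  dzbar_of_hasFDerivAt (hasFDerivAt_quarticPoly c z) j

theorem monomialBound_of_dbMono {m : BiIndex} (hm : m ∈ quartic) (j : Fin 2) {r : ℝ}
    {z z' : Phase} (hz : ‖z‖ ≤ r) (hz' : ‖z'‖ ≤ r) :
    ‖dbMono m j z‖ ≤ m.2 j * r ^ 3 ∧
      ‖dbMono m j z - dbMono m j z'‖ ≤ m.2 j * (3 * r ^ 2 * ‖z - z'‖) := by
  unfold dbMono
  rcases Nat.eq_zero_or_pos (m.2 j) with h | h
  · simp [h]
  have hd : degree (m.1, m.2 - Pi.single j 1) = 3 := by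
    have h4 := mem_quartic.1 hm
    simp only [degree, Fin.sum_univ_two] at h4 ⊢
    fin_cases j <;> simp at h ⊢ <;> omega
  have hb := monomialBound_mono (m.1, m.2 - Pi.single j 1)
  rw [hd] at hb
  obtain ⟨h1, h2⟩ := hb r z z' hz hz'
  rw [← mul_sub, norm_mul, norm_mul, Complex.norm_natCast]
  exact ⟨by gcongr, by gcongr; simpa using h2⟩

/-- Exchanging `α` and `β` preserves the moduli, so a weight defined through `α_j` also controls
`∂/∂z̄_j`, which brings down `β_j`. -/
theorem weight_eq_sum_snd {c : BiIndex → ℂ} (hc : ∀ m, ‖c m.swap‖ = ‖c m‖) (j : Fin 2) :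
    weight c j = ∑ m ∈ quartic, (m.2 j : ℝ) * ‖c m‖ := by
  rw [weight, ← sum_quartic_swap]
  simp [hc]

theorem weight_nonneg (c : BiIndex → ℂ) (j : Fin 2) : 0 ≤ weight c j :=
  Finset.sum_nonneg fun _ _ => by positivity

theorem norm_dbPoly_le {c : BiIndex → ℂ} (hc : ∀ m, ‖c m.swap‖ = ‖c m‖) (j : Fin 2) {r : ℝ}
    {z : Phase} (hz : ‖z‖ ≤ r) : ‖dbPoly c j z‖ ≤ weight c j * r ^ 3 := by
  rw [weight_eq_sum_snd hc, Finset.sum_mul]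
  refine norm_sum_le_of_le _ fun m hm => ?_
  rw [norm_mul]
  have := (monomialBound_of_dbMono hm j hz hz).1
  calc _ ≤ ‖c m‖ * (m.2 j * r ^ 3) := by gcongr
    _ = _ := by ring

theorem norm_dbPoly_sub_le {c : BiIndex → ℂ} (hc : ∀ m, ‖c m.swap‖ = ‖c m‖) (j : Fin 2) {r : ℝ}
    {z z' : Phase} (hz : ‖z‖ ≤ r) (hz' : ‖z'‖ ≤ r) :
    ‖dbPoly c j z - dbPoly c j z'‖ ≤ weight c j * (3 * r ^ 2 * ‖z - z'‖) := by
  rw [weight_eq_sum_snd hc, Finset.sum_mul, dbPoly, dbPoly, ← Finset.sum_sub_distrib]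
  refine norm_sum_le_of_le _ fun m hm => ?_
  rw [← mul_sub, norm_mul]
  have := (monomialBound_of_dbMono hm j hz hz').2
  calc _ ≤ ‖c m‖ * (m.2 j * (3 * r ^ 2 * ‖z - z'‖)) := by gcongr
    _ = _ := by ring

/-- The coefficients of a real-valued polynomial. -/
def IsRealCoeff (c : BiIndex → ℂ) : Prop := ∀ m, c m.swap = conj (c m)

theorem IsRealCoeff.norm_swap {c : BiIndex → ℂ} (hc : IsRealCoeff c) (m : BiIndex) :
    ‖c m.swap‖ = ‖c m‖ := by
  rw [hc m, RCLike.norm_conj]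

theorem IsRealCoeff.dzPoly_eq {c : BiIndex → ℂ} (hc : IsRealCoeff c) (j : Fin 2) (z : Phase) :
    dzPoly c j z = conj (dbPoly c j z) := by
  rw [dzPoly, dbPoly, ← sum_quartic_swap, map_sum]
  refine Finset.sum_congr rfl fun m _ => ?_
  rw [dzMono_swap, map_mul, hc m]

end MetaBNF

namespace MetaBNF

open ComplexConjugate

namespace Params

variable (P : Params)

/-! ### The coefficients -/

theorem gCoeff_swap (m : BiIndex) : P.gCoeff m.swap = P.gCoeff m := by
  simp only [gCoeff, Prod.fst_swap, Prod.snd_swap, add_comm, mul_comm]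

theorem divisor_swap (m : BiIndex) : P.divisor m.swap = -P.divisor m := by
  simp only [divisor, Prod.fst_swap, Prod.snd_swap, Fin.sum_univ_two]
  ring

theorem isRealCoeff_h4Coeff : IsRealCoeff P.h4Coeff := fun m => by
  simp only [h4Coeff, Prod.fst_swap, Prod.snd_swap, gCoeff_swap, eq_comm (a := m.2)]
  split_ifs <;> simp

theorem isRealCoeff_gHatCoeff : IsRealCoeff P.gHatCoeff := fun m => by
  rw [gHatCoeff, gHatCoeff, map_sub, P.isRealCoeff_h4Coeff, gCoeff_swap, Complex.conj_ofReal]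

theorem isRealCoeff_sCoeff : IsRealCoeff P.sCoeff := fun m => by
  simp only [sCoeff, Prod.fst_swap, Prod.snd_swap, gCoeff_swap, divisor_swap,
    eq_comm (a := m.2)]
  split_ifs
  · simp
  · simp [div_neg]

theorem divisor_ne_zero (hω₀ : 0 < P.ω 0) (hω₁ : P.ω 0 < P.ω 1) (hres : P.ω 1 ≠ 3 * P.ω 0)
    {m : BiIndex} (hm : m ∈ quartic) (hne : m.1 ≠ m.2) : P.divisor m ≠ 0 := by
  obtain ⟨α, β⟩ := m
  rw [mem_quartic] at hm
  simp only [degree, divisor, Fin.sum_univ_two] at hm hne ⊢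
  have hne' : ¬ (α 0 = β 0 ∧ α 1 = β 1) := fun h => hne (by
    funext j; fin_cases j
    · exact h.1
    · exact h.2)
  generalize α 0 = a at *
  generalize α 1 = b at *
  generalize β 0 = c at *
  generalize β 1 = d at *
  have ha : a ≤ 4 := by omega
  have hb : b ≤ 4 := by omega
  have hc : c ≤ 4 := by omega
  obtain rfl : d = 4 - a - b - c := by omega
  intro h0
  -- Finite check. Since `0 < ω₋ < ω₊`, the only possible vanishing of an off-diagonal divisor is
  -- `ω₊ = 3 ω₋`.
  interval_cases a <;> interval_cases b <;> interval_cases c <;>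
    first
    | omega
    | (norm_num at h0 hne'; first | linarith | exact hres (by linarith))

/-! ### The Hamiltonian as a polynomial -/

/-- The quadratic part `∑ j, ω_j |z_j|²`. -/
noncomputable def h2 (z : Phase) : ℂ := ∑ j, (P.ω j : ℂ) * (z j * conj (z j))

theorem hasFDerivAt_h2 (z : Phase) :
    HasFDerivAt P.h2
      (wirtinger (fun j => P.ω j * conj (z j)) (fun j => P.ω j * z j)) z := by
  have key := fun j : Fin 2 => (hasFDerivAt_wirtinger_mul (hasFDerivAt_coord j z)
    (hasFDerivAt_conj_coord j z)).const_mul (P.ω j : ℂ)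
  have h := HasFDerivAt.fun_sum (u := Finset.univ) fun j _ => key j
  convert! h using 1
  ext v
  simp [wirtinger_apply, Fin.sum_univ_two]
  ring

/-- The last exponent is determined by the other three, so the sum can be written out term by term.
-/
theorem sum_quartic_eq {M : Type*} [AddCommMonoid M] (f : BiIndex → M) :
    ∑ m ∈ quartic, f m = ∑ a ∈ Finset.range 5, ∑ b ∈ Finset.range (5 - a),
      ∑ c ∈ Finset.range (5 - a - b), f (![a, b], ![c, 4 - a - b - c]) := by
  have h : ∀ a ∈ Finset.range 5, ∑ b ∈ Finset.range (5 - a),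
      ∑ c ∈ Finset.range (5 - a - b), f (![a, b], ![c, 4 - a - b - c]) =
      ∑ x ∈ (Finset.range (5 - a)).sigma fun b => Finset.range (5 - a - b),
        f (![a, x.1], ![x.2, 4 - a - x.1 - x.2]) := fun a _ =>
    (Finset.sum_sigma _ _ fun x : (_ : ℕ) × ℕ => f (![a, x.1], ![x.2, 4 - a - x.1 - x.2])).symm
  rw [Finset.sum_congr rfl h, ← Finset.sum_sigma
    (f := fun x : (_ : ℕ) × (_ : ℕ) × ℕ =>
      f (![x.1, x.2.1], ![x.2.2, 4 - x.1 - x.2.1 - x.2.2]))]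
  refine Finset.sum_bij' (fun m _ => ⟨m.1 0, m.1 1, m.2 0⟩)
    (fun x _ => (![x.1, x.2.1], ![x.2.2, 4 - x.1 - x.2.1 - x.2.2])) ?_ ?_ ?_ ?_ ?_
  · intro m hm
    rw [mem_quartic] at hm
    simp only [degree, Fin.sum_univ_two] at hm
    simp only [Finset.mem_sigma, Finset.mem_range]
    omega
  · rintro ⟨a, b, c⟩ hx
    simp only [Finset.mem_sigma, Finset.mem_range] at hx
    rw [mem_quartic]
    simp only [degree, Fin.sum_univ_two, Matrix.cons_val_zero, Matrix.cons_val_one]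
    omega
  · intro m hm
    rw [mem_quartic] at hm
    simp only [degree, Fin.sum_univ_two] at hm
    refine Prod.ext ?_ ?_ <;> funext j <;> fin_cases j <;> simp
    omega
  · rintro ⟨a, b, c⟩ _
    simp
  · intro m hm
    congr 1
    rw [mem_quartic] at hm
    simp only [degree, Fin.sum_univ_two] at hm
    refine Prod.ext ?_ ?_ <;> funext j <;> fin_cases j <;> simp
    omega

theorem quarticPoly_gCoeff (z : Phase) :
    ((P.potential (2 * (z 0).re / √(2 * P.ω 0)) (2 * (z 1).re / √(2 * P.ω 1)) : ℝ) : ℂ) =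
      quarticPoly (fun m => (P.gCoeff m : ℂ)) z := by
  have hs : (√2 : ℝ) ^ 4 = 4 := by
    have : (√2 : ℝ) ^ 2 = 2 := Real.sq_sqrt (by norm_num)
    calc (√2 : ℝ) ^ 4 = (√2 ^ 2) ^ 2 := by ring
      _ = 4 := by rw [this]; norm_num
  have hq : ∀ A B x y : ℝ, (A * (x / √(2 * P.ω 0)) + B * (y / √(2 * P.ω 1))) ^ 4 =
      (1 / 4) * (A * x * (√(P.ω 0))⁻¹ + B * y * (√(P.ω 1))⁻¹) ^ 4 := fun A B x y => by
    rw [Real.sqrt_mul (by norm_num), Real.sqrt_mul (by norm_num)]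
    have : A * (x / (√2 * √(P.ω 0))) + B * (y / (√2 * √(P.ω 1))) =
        (A * x * (√(P.ω 0))⁻¹ + B * y * (√(P.ω 1))⁻¹) / √2 := by
      field_simp
    rw [this, div_pow, hs]
    ring
  have hre : ∀ w : ℂ, ((2 * w.re : ℝ) : ℂ) = w + conj w := fun w => by
    rw [Complex.add_conj]
  rw [potential, hq, hq, quarticPoly_eq, sum_quartic_eq]
  push_cast
  have h0 := hre (z 0)
  have h1 := hre (z 1)
  push_cast at h0 h1
  rw [h0, h1]
  simp only [Finset.sum_range_succ, Finset.sum_range_zero, gCoeff, fCoeff, mono,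
    Fin.prod_univ_two, Nat.factorial, Matrix.cons_val_zero, Matrix.cons_val_one]
  norm_num [Nat.factorial]
  ring

theorem hamiltonian_eq (z : Phase) :
    P.hamiltonian z = P.h2 z + quarticPoly (fun m => (P.gCoeff m : ℂ)) z := by
  rw [← P.quarticPoly_gCoeff, hamiltonian, h2]
  push_cast
  simp only [Fin.sum_univ_two, Complex.mul_conj, Complex.normSq_eq_norm_sq]
  push_cast
  ring

theorem quarticPoly_split (z : Phase) : quarticPoly (fun m => (P.gCoeff m : ℂ)) z =
    quarticPoly P.h4Coeff z + quarticPoly P.gHatCoeff z := by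
  simp only [quarticPoly_eq, ← Finset.sum_add_distrib, ← add_mul, gHatCoeff,
    add_sub_cancel]

/-- The homological equation `{H₂, S} = -Ĝ`. -/
theorem homological_equation (hω₀ : 0 < P.ω 0) (hω₁ : P.ω 0 < P.ω 1) (hres : P.ω 1 ≠ 3 * P.ω 0)
    (z : Phase) :
    wirtinger (fun j => P.ω j * conj (z j)) (fun j => P.ω j * z j)
      (fun j => -Complex.I * dbPoly P.sCoeff j z) = -quarticPoly P.gHatCoeff z := by
  have h1 : ∀ j, conj (-Complex.I * dbPoly P.sCoeff j z) =
      Complex.I * dzPoly P.sCoeff j z := fun j => by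
    rw [P.isRealCoeff_sCoeff.dzPoly_eq]; simp
  rw [wirtinger_apply, quarticPoly_eq, ← Finset.sum_neg_distrib]
  simp only [h1]
  simp only [dzPoly, dbPoly, Finset.mul_sum]
  simp only [← Finset.sum_add_distrib]
  rw [Finset.sum_comm]
  refine Finset.sum_congr rfl fun m hm => ?_
  -- Euler's identities: `z_j ∂/∂z_j - z̄_j ∂/∂z̄_j` multiplies `z^α z̄^β` by `α_j - β_j`. Summing
  -- over `j` with weights `ω_j` produces the divisor, which cancels the one in `S`.
  have h2 : ∀ j, (P.ω j : ℂ) * conj (z j) * (-Complex.I * (P.sCoeff m * dbMono m j z)) +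
      P.ω j * z j * (Complex.I * (P.sCoeff m * dzMono m j z)) =
      Complex.I * P.sCoeff m * (P.ω j * ((m.1 j : ℂ) - m.2 j)) * mono m z := fun j => by
    have e1 := dzMono_mul m j z
    have e2 := dbMono_mul m j z
    linear_combination (Complex.I * P.sCoeff m * P.ω j) * (e1 - e2)
  rw [Finset.sum_congr rfl fun j _ => h2 j, ← Finset.sum_mul, ← Finset.mul_sum]
  have h3 : (∑ j, (P.ω j : ℂ) * ((m.1 j : ℂ) - m.2 j)) = (P.divisor m : ℂ) := by
    simp [divisor]
  rw [h3, gHatCoeff, h4Coeff, sCoeff]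
  split_ifs with h
  · simp
  · have hd : (P.divisor m : ℂ) ≠ 0 := by
      exact_mod_cast P.divisor_ne_zero hω₀ hω₁ hres hm h
    push_cast
    field_simp
    simp [Complex.I_sq]
    ring

/-! ### The integrable quartic part -/

theorem hasFDerivAt_h4Action (I : Fin 2 → ℝ) :
    HasFDerivAt P.h4Action
      ((2 * P.gCoeff (![2, 0], ![2, 0]) * I 0 + P.gCoeff (![1, 1], ![1, 1]) * I 1) •
          ContinuousLinearMap.proj (R := ℝ) (φ := fun _ : Fin 2 => ℝ) 0 +
        (P.gCoeff (![1, 1], ![1, 1]) * I 0 + 2 * P.gCoeff (![0, 2], ![0, 2]) * I 1) •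
          ContinuousLinearMap.proj (R := ℝ) (φ := fun _ : Fin 2 => ℝ) 1) I := by
  have h0 := (ContinuousLinearMap.proj (R := ℝ) (φ := fun _ : Fin 2 => ℝ) 0).hasFDerivAt (x := I)
  have h1 := (ContinuousLinearMap.proj (R := ℝ) (φ := fun _ : Fin 2 => ℝ) 1).hasFDerivAt (x := I)
  have h := (((h0.pow 2).const_mul (P.gCoeff (![2, 0], ![2, 0]))).add
    ((h0.mul h1).const_mul (P.gCoeff (![1, 1], ![1, 1])))).add
    ((h1.pow 2).const_mul (P.gCoeff (![0, 2], ![0, 2])))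
  convert! h using 1
  ext v
  simp
  ring

theorem hessian_mulVec (I : Fin 2 → ℝ) (j : Fin 2) :
    P.hessian.mulVec I j =
      ![2 * P.gCoeff (![2, 0], ![2, 0]) * I 0 + P.gCoeff (![1, 1], ![1, 1]) * I 1,
        P.gCoeff (![1, 1], ![1, 1]) * I 0 + 2 * P.gCoeff (![0, 2], ![0, 2]) * I 1] j := by
  have h0 := (ContinuousLinearMap.proj (R := ℝ) (φ := fun _ : Fin 2 => ℝ) 0).hasFDerivAt
    (x := (0 : Fin 2 → ℝ))
  have h1 := (ContinuousLinearMap.proj (R := ℝ) (φ := fun _ : Fin 2 => ℝ) 1).hasFDerivAt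
    (x := (0 : Fin 2 → ℝ))
  have e0 := ((h0.const_mul (2 * P.gCoeff (![2, 0], ![2, 0]))).add
    (h1.const_mul (P.gCoeff (![1, 1], ![1, 1])))).fderiv
  have e1 := ((h0.const_mul (P.gCoeff (![1, 1], ![1, 1]))).add
    (h1.const_mul (2 * P.gCoeff (![0, 2], ![0, 2])))).fderiv
  have hd0 : (fun I : Fin 2 → ℝ => fderiv ℝ P.h4Action I (Pi.single 0 1)) = fun I =>
      2 * P.gCoeff (![2, 0], ![2, 0]) * I 0 + P.gCoeff (![1, 1], ![1, 1]) * I 1 := by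
    funext I
    rw [(P.hasFDerivAt_h4Action I).fderiv]
    simp
  have hd1 : (fun I : Fin 2 → ℝ => fderiv ℝ P.h4Action I (Pi.single 1 1)) = fun I =>
      P.gCoeff (![1, 1], ![1, 1]) * I 0 + 2 * P.gCoeff (![0, 2], ![0, 2]) * I 1 := by
    funext I
    rw [(P.hasFDerivAt_h4Action I).fderiv]
    simp
  have e0' : fderiv ℝ (fun I : Fin 2 → ℝ => 2 * P.gCoeff (![2, 0], ![2, 0]) * I 0 +
    P.gCoeff (![1, 1], ![1, 1]) * I 1) 0 = _ := e0
  have e1' : fderiv ℝ (fun I : Fin 2 → ℝ => P.gCoeff (![1, 1], ![1, 1]) * I 0 +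
    2 * P.gCoeff (![0, 2], ![0, 2]) * I 1) 0 = _ := e1
  fin_cases j <;>
    simp [Matrix.mulVec, dotProduct, Fin.sum_univ_two, hessian, hd0, hd1, e0', e1']

/-- Chain rule for a function of `I_j = |z_j|²`: the gradient of the quadratic form `h4Action` is `A
I`. Hence the frequencies `ω + A I` of the integrable part. -/
theorem dbPoly_h4Coeff (z : Phase) (j : Fin 2) :
    dbPoly P.h4Coeff j z = (P.hessian.mulVec (fun i => ‖z i‖ ^ 2) j : ℝ) * z j := by
  have e : ∀ x : ℂ, ((‖x‖ : ℝ) : ℂ) ^ 2 = x * conj x := fun x => by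
    rw [Complex.mul_conj, Complex.normSq_eq_norm_sq]; push_cast; ring
  rw [hessian_mulVec, dbPoly, sum_quartic_eq]
  fin_cases j <;>
    simp [Finset.sum_range_succ, h4Coeff, dbMono, mono, Fin.prod_univ_two, e] <;> ring

theorem norm_hessian_mulVec_le (x : Fin 2 → ℝ) :
    ‖P.hessian.mulVec x‖ ≤ P.hessianNorm * ‖x‖ :=
  (LinearMap.toContinuousLinearMap (Matrix.toLin' P.hessian)).le_opNorm x

end Params

end MetaBNF

namespace MetaBNF

open ComplexConjugate Set Filter Topology

/-! ### The flow of a quartic Hamiltonian -/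

section Flow

variable {c : BiIndex → ℂ} {σ : ℝ}

theorem hamField_quarticPoly (c : BiIndex → ℂ) (z : Phase) (j : Fin 2) :
    hamField (quarticPoly c) z j = -Complex.I * dbPoly c j z := by
  rw [hamField, dzbar_quarticPoly]

theorem norm_hamField_quarticPoly_le (hc : IsRealCoeff c) (hσ : ∀ j, weight c j ≤ σ) {r : ℝ}
    {z : Phase} (hz : ‖z‖ ≤ r) : ‖hamField (quarticPoly c) z‖ ≤ σ * r ^ 3 := by
  have hr : 0 ≤ r := (norm_nonneg z).trans hz
  have hσ0 : 0 ≤ σ := (weight_nonneg c 0).trans (hσ 0)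
  refine (pi_norm_le_iff_of_nonneg (by positivity)).2 fun j => ?_
  rw [hamField_quarticPoly, norm_mul, norm_neg, Complex.norm_I, one_mul]
  refine (norm_dbPoly_le hc.norm_swap j hz).trans ?_
  gcongr
  exact hσ j

theorem norm_hamField_quarticPoly_sub_le (hc : IsRealCoeff c) (hσ : ∀ j, weight c j ≤ σ) {r : ℝ}
    {z z' : Phase} (hz : ‖z‖ ≤ r) (hz' : ‖z'‖ ≤ r) :
    ‖hamField (quarticPoly c) z - hamField (quarticPoly c) z'‖ ≤ 3 * σ * r ^ 2 * ‖z - z'‖ := by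
  have hr : 0 ≤ r := (norm_nonneg z).trans hz
  have hσ0 : 0 ≤ σ := (weight_nonneg c 0).trans (hσ 0)
  refine (pi_norm_le_iff_of_nonneg (by positivity)).2 fun j => ?_
  rw [Pi.sub_apply, hamField_quarticPoly, hamField_quarticPoly, ← mul_sub, norm_mul, norm_neg,
    Complex.norm_I, one_mul]
  refine (norm_dbPoly_sub_le hc.norm_swap j hz hz').trans ?_
  calc weight c j * (3 * r ^ 2 * ‖z - z'‖) ≤ σ * (3 * r ^ 2 * ‖z - z'‖) := by
        gcongr
        exact hσ j
    _ = _ := by ring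

theorem lipschitzOnWith_hamField_quarticPoly (hc : IsRealCoeff c) (hσ : ∀ j, weight c j ≤ σ)
    (r : ℝ) : LipschitzOnWith (Real.toNNReal (3 * σ * r ^ 2)) (hamField (quarticPoly c))
      (Metric.closedBall 0 r) := by
  have hσ0 : 0 ≤ σ := (weight_nonneg c 0).trans (hσ 0)
  refine LipschitzOnWith.of_dist_le_mul fun z hz z' hz' => ?_
  rw [Real.coe_toNNReal _ (by positivity), dist_eq_norm, dist_eq_norm]
  rw [mem_closedBall_zero_iff] at hz hz'
  exact norm_hamField_quarticPoly_sub_le hc hσ hz hz'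

theorem IsSolutionOn.continuousOn {F : Phase → ℂ} {J : Set ℝ} {u : ℝ → Phase}
    (hu : IsSolutionOn F J u) : ContinuousOn u J :=
  fun t ht => (hu t ht).continuousWithinAt

theorem IsSolutionOn.hasDerivWithinAt_Ici {F : Phase → ℂ} {a b : ℝ} {u : ℝ → Phase}
    (hu : IsSolutionOn F (Icc a b) u) {t : ℝ} (ht : t ∈ Ico a b) :
    HasDerivWithinAt u (hamField F (u t)) (Ici t) t :=
  (hu t (Ico_subset_Icc_self ht)).mono_of_mem_nhdsWithin (Icc_mem_nhdsGE_of_mem ht)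

theorem dist_le_of_isSolutionOn (hc : IsRealCoeff c) (hσ : ∀ j, weight c j ≤ σ) {r : ℝ}
    {u v : ℝ → Phase} (hu : IsSolutionOn (quarticPoly c) (Icc 0 1) u)
    (hv : IsSolutionOn (quarticPoly c) (Icc 0 1) v) (hur : ∀ t ∈ Icc (0 : ℝ) 1, ‖u t‖ ≤ r)
    (hvr : ∀ t ∈ Icc (0 : ℝ) 1, ‖v t‖ ≤ r) {t : ℝ} (ht : t ∈ Icc (0 : ℝ) 1) :
    ‖u t - v t‖ ≤ ‖u 0 - v 0‖ * Real.exp (3 * σ * r ^ 2 * t) := by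
  have hσ0 : 0 ≤ σ := (weight_nonneg c 0).trans (hσ 0)
  have h := dist_le_of_trajectories_ODE_of_mem
    (v := fun _ => hamField (quarticPoly c)) (s := fun _ => Metric.closedBall 0 r)
    (fun _ _ => lipschitzOnWith_hamField_quarticPoly hc hσ r)
    hu.continuousOn (fun t ht => hu.hasDerivWithinAt_Ici ht)
    (fun t ht => mem_closedBall_zero_iff.2 (hur t (Ico_subset_Icc_self ht)))
    hv.continuousOn (fun t ht => hv.hasDerivWithinAt_Ici ht)
    (fun t ht => mem_closedBall_zero_iff.2 (hvr t (Ico_subset_Icc_self ht))) le_rfl t ht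
  rwa [Real.coe_toNNReal _ (by positivity), sub_zero, dist_eq_norm, dist_eq_norm] at h

theorem eqOn_of_isSolutionOn (hc : IsRealCoeff c) {u v : ℝ → Phase}
    (hu : IsSolutionOn (quarticPoly c) (Icc 0 1) u)
    (hv : IsSolutionOn (quarticPoly c) (Icc 0 1) v) (h0 : u 0 = v 0) :
    EqOn u v (Icc 0 1) := by
  -- Both arcs are compact, so they lie in a common ball on which the field is Lipschitz and
  -- Grönwall applies.
  obtain ⟨r₁, h₁⟩ := isCompact_Icc.exists_bound_of_continuousOn hu.continuousOn
  obtain ⟨r₂, h₂⟩ := isCompact_Icc.exists_bound_of_continuousOn hv.continuousOn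
  intro t ht
  have h := dist_le_of_isSolutionOn hc (σ := max (weight c 0) (weight c 1))
    (Fin.forall_fin_two.2 ⟨le_max_left _ _, le_max_right _ _⟩) hu hv
    (r := max r₁ r₂) (fun t ht => (h₁ t ht).trans (le_max_left _ _))
    (fun t ht => (h₂ t ht).trans (le_max_right _ _)) ht
  rw [h0, sub_self, norm_zero, zero_mul] at h
  exact sub_eq_zero.1 (norm_le_zero_iff.1 h)

theorem timeOneMap_eq (hc : IsRealCoeff c) {u : ℝ → Phase} {w : Phase} (h0 : u 0 = w)
    (hu : IsSolutionOn (quarticPoly c) (Icc 0 1) u) : timeOneMap (quarticPoly c) w = u 1 := by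
  have h : ∃ u : ℝ → Phase, u 0 = w ∧ IsSolutionOn (quarticPoly c) (Icc 0 1) u := ⟨u, h0, hu⟩
  rw [timeOneMap, dif_pos h]
  exact eqOn_of_isSolutionOn hc h.choose_spec.2 hu (h.choose_spec.1.trans h0.symm)
    (right_mem_Icc.2 zero_le_one)

/-- The flow exists up to time one for small data, and grows at most by a factor `3 / 2`. -/
theorem exists_isSolutionOn (hc : IsRealCoeff c) (hσ : ∀ j, weight c j ≤ σ) {w : Phase}
    (hw : σ * ‖w‖ ^ 2 ≤ 4 / 27) :
    ∃ u : ℝ → Phase, u 0 = w ∧ IsSolutionOn (quarticPoly c) (Icc 0 1) u ∧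
      ∀ t, ‖u t‖ ≤ 3 / 2 * ‖w‖ := by
  have hσ0 : 0 ≤ σ := (weight_nonneg c 0).trans (hσ 0)
  have hball : ∀ z ∈ Metric.closedBall w ((‖w‖₊ / 2 : NNReal) : ℝ), ‖z‖ ≤ 3 / 2 * ‖w‖ := by
    intro z hz
    rw [mem_closedBall_iff_norm] at hz
    have := norm_le_norm_add_norm_sub' z w
    simp only [NNReal.coe_div, coe_nnnorm, NNReal.coe_ofNat] at hz
    linarith
  -- In the ball of radius `‖w‖/2` about `w` the speed is at most `σ (3/2 ‖w‖)³`. The constant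
  -- `4/27` makes this at most `‖w‖/2`, so the ball is not left within unit time.
  have hPL : IsPicardLindelof (fun _ : ℝ => hamField (quarticPoly c))
      (⟨0, left_mem_Icc.2 zero_le_one⟩ : Icc (0 : ℝ) 1) w (‖w‖₊ / 2) 0 (‖w‖₊ / 2)
      (Real.toNNReal (3 * σ * (3 / 2 * ‖w‖) ^ 2)) := by
    refine ⟨fun _ _ => ?_, fun _ _ => continuousOn_const, fun _ _ z hz => ?_, ?_⟩
    · exact (lipschitzOnWith_hamField_quarticPoly hc hσ _).mono fun z hz =>
        mem_closedBall_zero_iff.2 (hball z hz)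
    · refine (norm_hamField_quarticPoly_le hc hσ (hball z hz)).trans ?_
      simp only [NNReal.coe_div, coe_nnnorm, NNReal.coe_ofNat]
      calc σ * (3 / 2 * ‖w‖) ^ 3 = σ * ‖w‖ ^ 2 * (27 / 8 * ‖w‖) := by ring
        _ ≤ 4 / 27 * (27 / 8 * ‖w‖) := by gcongr
        _ = _ := by ring
    · simp
  -- The Picard fixed point is kept in hand because it carries the confinement to the ball as well
  -- as the equation.
  obtain ⟨α, hα⟩ := ODE.FunSpace.exists_isFixedPt_next hPL (Metric.mem_closedBall_self le_rfl)
  have hmem : ∀ t, α.compProj t ∈ Metric.closedBall w ((‖w‖₊ / 2 : NNReal) : ℝ) := fun t =>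
    α.compProj_mem_closedBall hPL.mul_max_le
  refine ⟨α.compProj, ?_, fun t ht => ?_, fun t => hball _ (hmem t)⟩
  · have := ODE.FunSpace.compProj_val (α := α) (t := ⟨0, left_mem_Icc.2 zero_le_one⟩)
    rw [← hα, ODE.FunSpace.next_apply₀] at this
    rw [← hα]
    exact this
  · apply ODE.hasDerivWithinAt_picard_Icc (left_mem_Icc.2 zero_le_one) hPL.continuousOn_uncurry
      α.continuous_compProj.continuousOn (fun t _ => hmem t) w ht |>.congr_of_mem _ ht
    intro t' ht'
    nth_rw 1 [← hα]
    rw [ODE.FunSpace.compProj_of_mem ht', ODE.FunSpace.next_apply]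

end Flow

/-! ### Smooth dependence on the initial datum -/

/-- Pairs of continuous functions on `[0, 1]`: the coordinates of a curve in phase space. -/
abbrev Curve : Type := Fin 2 → C(unitInterval, ℂ)

/-- Integration from `0`, as an operator on continuous functions on `[0, 1]`. -/
noncomputable def primitive : C(unitInterval, ℂ) →L[ℝ] C(unitInterval, ℂ) :=
  LinearMap.mkContinuous
    { toFun := fun f => ⟨fun t => ∫ s in (0 : ℝ)..t, f (projIcc 0 1 zero_le_one s),
        (intervalIntegral.continuous_primitive (fun a b =>
          (f.continuous.comp continuous_projIcc).intervalIntegrable a b) 0).comp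
          continuous_subtype_val⟩
      map_add' := fun f g => by
        ext t
        exact intervalIntegral.integral_add
          ((f.continuous.comp continuous_projIcc).intervalIntegrable _ _)
          ((g.continuous.comp continuous_projIcc).intervalIntegrable _ _)
      map_smul' := fun k f => by
        ext t
        simp } 1 (fun f => by
      rw [one_mul]
      refine (ContinuousMap.norm_le _ (norm_nonneg f)).2 fun t => ?_
      have h := intervalIntegral.norm_integral_le_of_norm_le_const (a := 0) (b := (t : ℝ))
        (f := fun s => f (projIcc 0 1 zero_le_one s)) (C := ‖f‖)
        (fun s _ => f.norm_coe_le_norm _)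
      refine h.trans ?_
      rw [sub_zero, abs_of_nonneg t.2.1]
      exact mul_le_of_le_one_right (norm_nonneg f) t.2.2)

theorem norm_primitive_le (f : C(unitInterval, ℂ)) : ‖primitive f‖ ≤ ‖f‖ := by
  have h := LinearMap.mkContinuous_norm_le _ zero_le_one _ |> primitive.le_of_opNorm_le <| f
  simpa using h

/-- The superposition operator of the Hamiltonian field of a quartic polynomial. -/
noncomputable def superposition (c : BiIndex → ℂ) (u : Curve) : Curve := fun j =>
  ∑ m ∈ quartic, ContinuousMap.const unitInterval (-Complex.I * (c m * m.2 j)) *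
    ∏ i, (u i ^ m.1 i * star (u i) ^ (m.2 - Pi.single j 1 : Fin 2 → ℕ) i)

theorem superposition_apply (c : BiIndex → ℂ) (u : Curve) (j : Fin 2) (t : unitInterval) :
    superposition c u j t = hamField (quarticPoly c) (fun i => u i t) j := by
  rw [hamField_quarticPoly, superposition, dbPoly, ContinuousMap.sum_apply, Finset.mul_sum]
  refine Finset.sum_congr rfl fun m _ => ?_
  simp [dbMono, mono, Fin.prod_univ_two]
  ring

/-- The operator is a polynomial in `u` and `star u` in the algebra of continuous functions. -/
theorem contDiff_superposition (c : BiIndex → ℂ) {n : WithTop ℕ∞} :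
    ContDiff ℝ n (superposition c) := by
  refine contDiff_pi.2 fun j => ContDiff.sum fun m _ => contDiff_const.mul ?_
  refine contDiff_prod fun i _ => ?_
  have h1 : ContDiff ℝ n fun u : Curve => u i := contDiff_apply ℝ _ i
  have h2 : ContDiff ℝ n fun u : Curve => star (u i) :=
    (starL' ℝ : C(unitInterval, ℂ) ≃L[ℝ] C(unitInterval, ℂ)).contDiff.comp h1
  exact (h1.pow _).mul (h2.pow _)

theorem norm_curve_apply_le (u : Curve) (t : unitInterval) : ‖(fun i => u i t : Phase)‖ ≤ ‖u‖ :=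
  (pi_norm_le_iff_of_nonneg (norm_nonneg u)).2 fun i =>
    ((u i).norm_coe_le_norm t).trans (norm_le_pi_norm u i)

theorem norm_superposition_sub_le {c : BiIndex → ℂ} (hc : IsRealCoeff c) {σ : ℝ}
    (hσ : ∀ j, weight c j ≤ σ) {r : ℝ} {u v : Curve} (hu : ‖u‖ ≤ r) (hv : ‖v‖ ≤ r) :
    ‖superposition c u - superposition c v‖ ≤ 3 * σ * r ^ 2 * ‖u - v‖ := by
  have hr : 0 ≤ r := (norm_nonneg u).trans hu
  have hσ0 : 0 ≤ σ := (weight_nonneg c 0).trans (hσ 0)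
  refine (pi_norm_le_iff_of_nonneg (by positivity)).2 fun j =>
    (ContinuousMap.norm_le _ (by positivity)).2 fun t => ?_
  rw [Pi.sub_apply, ContinuousMap.sub_apply, superposition_apply, superposition_apply,
    ← Pi.sub_apply]
  refine (norm_le_pi_norm _ j).trans ((norm_hamField_quarticPoly_sub_le hc hσ
    ((norm_curve_apply_le u t).trans hu) ((norm_curve_apply_le v t).trans hv)).trans ?_)
  gcongr
  exact norm_curve_apply_le (u - v) t

/-- Componentwise integration from `0`. -/
noncomputable def curvePrimitive : Curve →L[ℝ] Curve :=
  ContinuousLinearMap.pi fun j => primitive.comp (ContinuousLinearMap.proj j)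

theorem norm_curvePrimitive_le (u : Curve) : ‖curvePrimitive u‖ ≤ ‖u‖ :=
  (pi_norm_le_iff_of_nonneg (norm_nonneg u)).2 fun j =>
    (norm_primitive_le (u j)).trans (norm_le_pi_norm u j)

/-- The map `u ↦ u - ∫ X(u)`; a curve solves the initial value problem with datum `w` exactly if
its image is the constant `w`. -/
noncomputable def integralDefect (c : BiIndex → ℂ) (u : Curve) : Curve :=
  u - curvePrimitive (superposition c u)

/-- The constant curves. -/
noncomputable def constCurve : Phase →L[ℝ] Curve :=
  ContinuousLinearMap.pi fun j =>
    (ContinuousLinearMap.const ℝ unitInterval).comp (ContinuousLinearMap.proj j)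

/-- The end point of a curve. -/
noncomputable def endpoint : Curve →L[ℝ] Phase :=
  ContinuousLinearMap.pi fun j =>
    (ContinuousMap.evalCLM ℝ (1 : unitInterval)).comp (ContinuousLinearMap.proj j)

theorem isSolutionOn_of_integralDefect {c : BiIndex → ℂ} {u : Curve} {w : Phase}
    (h : integralDefect c u = constCurve w) :
    ∃ v : ℝ → Phase, v 0 = w ∧ IsSolutionOn (quarticPoly c) (Icc 0 1) v ∧ v 1 = endpoint u := by
  have hu : ∀ (j : Fin 2) (t : unitInterval), u j t = w j +
      ∫ s in (0 : ℝ)..t, superposition c u j (projIcc 0 1 zero_le_one s) := by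
    intro j t
    have := congrArg (fun f : Curve => f j t) h
    exact sub_eq_iff_eq_add.1 this
  refine ⟨fun t j => u j (projIcc 0 1 zero_le_one t), ?_, fun t ht => ?_, ?_⟩
  · funext j
    change u j (projIcc 0 1 zero_le_one 0) = w j
    rw [projIcc_left, hu]
    simp
  · refine hasDerivWithinAt_pi.2 fun j => ?_
    have hcont : Continuous fun s => superposition c u j (projIcc 0 1 zero_le_one s) :=
      (superposition c u j).continuous.comp continuous_projIcc
    have hd := ((hcont.integral_hasStrictDerivAt 0 t).hasDerivAt.const_add
      (w j)).hasDerivWithinAt (s := Icc 0 1)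
    rw [superposition_apply] at hd
    refine hd.congr_of_mem (fun s hs => ?_) ht
    rw [hu, projIcc_of_mem zero_le_one hs]
  · funext j
    simp [endpoint]

theorem integralDefect_of_isSolutionOn {c : BiIndex → ℂ} {v : ℝ → Phase}
    (hv : IsSolutionOn (quarticPoly c) (Icc 0 1) v) :
    ∃ u : Curve, (∀ j (t : unitInterval), u j t = v t j) ∧
      integralDefect c u = constCurve (v 0) := by
  have hvj : ∀ j, ContinuousOn (fun t => v t j) (Icc 0 1) := fun j =>
    (continuous_apply j).comp_continuousOn hv.continuousOn
  let u : Curve := fun j => ⟨fun t => v t j, (hvj j).domRestrict⟩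
  have hu : ∀ j (t : unitInterval), u j t = v t j := fun _ _ => rfl
  refine ⟨u, hu, ?_⟩
  funext j
  ext t
  have hcont : Continuous fun s => superposition c u j (projIcc 0 1 zero_le_one s) :=
    (superposition c u j).continuous.comp continuous_projIcc
  have hint := intervalIntegral.integral_eq_sub_of_hasDerivAt_of_le t.2.1
    ((hvj j).mono (Icc_subset_Icc_right t.2.2))
    (f' := fun s => superposition c u j (projIcc 0 1 zero_le_one s)) (fun s hs => ?_)
    (hcont.intervalIntegrable _ _)
  · change u j t - ∫ s in (0 : ℝ)..t, superposition c u j (projIcc 0 1 zero_le_one s) = v 0 j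
    rw [hint, hu]
    ring
  · have hs' : s ∈ Icc (0 : ℝ) 1 := ⟨hs.1.le, hs.2.le.trans t.2.2⟩
    have hd := hasDerivWithinAt_pi.1 (hv s hs') j
    rw [superposition_apply, projIcc_of_mem zero_le_one hs']
    exact hd.hasDerivAt (Icc_mem_nhds hs.1 (hs.2.trans_le t.2.2))

/-- Near `w` the time-one map is the endpoint of the local inverse of `integralDefect` at the
constant curve. The derivative of `integralDefect` is `1 - A` with `‖A‖ < 1`, so the inverse
function theorem applies. -/
theorem contDiffAt_timeOneMap {c : BiIndex → ℂ} (hc : IsRealCoeff c) {σ : ℝ}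
    (hσ : ∀ j, weight c j ≤ σ) {w : Phase} (hw : σ * ‖w‖ ^ 2 < 4 / 27) {n : WithTop ℕ∞}
    (hn : n ≠ 0) : ContDiffAt ℝ n (timeOneMap (quarticPoly c)) w := by
  have hσ0 : 0 ≤ σ := (weight_nonneg c 0).trans (hσ 0)
  obtain ⟨v, hv0, hv, hvr⟩ := exists_isSolutionOn hc hσ hw.le
  obtain ⟨u, huv, hu⟩ := integralDefect_of_isSolutionOn hv
  rw [hv0] at hu
  have hunorm : ‖u‖ ≤ 3 / 2 * ‖w‖ := by
    refine (pi_norm_le_iff_of_nonneg (by positivity)).2 fun j =>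
      (ContinuousMap.norm_le _ (by positivity)).2 fun t => ?_
    rw [huv]
    exact (norm_le_pi_norm _ j).trans (hvr t)
  -- A radius slightly above `‖u‖` gives a contraction on a whole neighbourhood of `u`, as needed to
  -- bound the derivative. Since `3 (3/2)² = 27/4`, the threshold is again `4/27`.
  obtain ⟨ρ, hρ, huρ⟩ : ∃ ρ : ℝ, 3 * σ * ρ ^ 2 < 1 ∧ ‖u‖ < ρ := by
    have hlt : 3 * σ * ‖u‖ ^ 2 < 1 := by
      calc 3 * σ * ‖u‖ ^ 2 ≤ 3 * σ * (3 / 2 * ‖w‖) ^ 2 := by gcongr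
        _ = 27 / 4 * (σ * ‖w‖ ^ 2) := by ring
        _ < 1 := by linarith
    have hcont : ContinuousAt (fun ρ : ℝ => 3 * σ * ρ ^ 2) ‖u‖ := by fun_prop
    have h1 : ∀ᶠ ρ in 𝓝[>] ‖u‖, 3 * σ * ρ ^ 2 < 1 :=
      (hcont.eventually (gt_mem_nhds hlt)).filter_mono nhdsWithin_le_nhds
    exact (h1.and self_mem_nhdsWithin).exists
  have hdiff : ContDiff ℝ n fun u => curvePrimitive (superposition c u) :=
    curvePrimitive.contDiff.comp (contDiff_superposition c)
  set A : Curve →L[ℝ] Curve := fderiv ℝ (fun u => curvePrimitive (superposition c u)) u with hA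
  have hA1 : ‖A‖ < 1 := by
    refine (norm_fderiv_le_of_lip' ℝ (C := 3 * σ * ρ ^ 2) (by positivity) ?_).trans_lt hρ
    filter_upwards [continuous_norm.continuousAt.eventually (gt_mem_nhds huρ)] with x hx
    rw [← map_sub]
    exact (norm_curvePrimitive_le _).trans (norm_superposition_sub_le hc hσ hx.le huρ.le)
  let e : Curve ≃L[ℝ] Curve := ContinuousLinearEquiv.unitsEquiv ℝ Curve (Units.oneSub A hA1)
  have hG : ContDiffAt ℝ n (integralDefect c) u := (contDiff_id.sub hdiff).contDiffAt
  have hG' : HasFDerivAt (integralDefect c) (e : Curve →L[ℝ] Curve) u :=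
    (hasFDerivAt_id u).sub (hdiff.differentiable hn u).hasFDerivAt
  have hinv := hG.to_localInverse hG' hn
  have hright := (hG.hasStrictFDerivAt' hG' hn).eventually_right_inverse
  rw [hu] at hinv hright
  have hsmooth : ContDiffAt ℝ n
      (fun w' => endpoint (hG.localInverse hG' hn (constCurve w'))) w :=
    endpoint.contDiff.contDiffAt.comp w (hinv.comp w constCurve.contDiff.contDiffAt)
  refine hsmooth.congr_of_eventuallyEq ?_
  filter_upwards [constCurve.continuous.continuousAt.eventually hright] with w' hw'
  obtain ⟨v', h0, hsol, h1⟩ := isSolutionOn_of_integralDefect hw'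
  rw [timeOneMap_eq hc h0 hsol, h1]
  rfl

end MetaBNF

/-! ### The remainder of the normal form and its gradient. -/

namespace MetaBNF

open ComplexConjugate Set Filter Topology

theorem norm_mul_sub_mul_le {a b a' b' : ℂ} {A B A' B' : ℝ} (ha : ‖a‖ ≤ A) (hb : ‖b'‖ ≤ B)
    (ha' : ‖a - a'‖ ≤ A') (hb' : ‖b - b'‖ ≤ B') : ‖a * b - a' * b'‖ ≤ A * B' + A' * B := by
  have e : a * b - a' * b' = a * (b - b') + (a - a') * b' := by ring
  have hA : 0 ≤ A := (norm_nonneg a).trans ha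
  have hA' : 0 ≤ A' := (norm_nonneg _).trans ha'
  rw [e]
  refine (norm_add_le _ _).trans ?_
  rw [norm_mul, norm_mul]
  gcongr

namespace Params

variable (P : Params)

/-- The derivative of a quartic polynomial along the Hamiltonian field of the generator. -/
noncomputable def bracket (c : BiIndex → ℂ) (z : Phase) : ℂ :=
  wirtinger (fun j => dzPoly c j z) (fun j => dbPoly c j z) (hamField P.generator z)

/-- Each `j` contributes two products of cubic factors, one conjugate to the other in type; each
product has a Lipschitz factor `3 + 3`, whence `12`. -/
theorem norm_bracket_sub_le {c : BiIndex → ℂ} (hc : IsRealCoeff c) {r : ℝ} {z z' : Phase}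
    (hz : ‖z‖ ≤ r) (hz' : ‖z'‖ ≤ r) :
    ‖P.bracket c z - P.bracket c z'‖ ≤
      12 * (∑ j, weight P.sCoeff j * weight c j) * r ^ 5 * ‖z - z'‖ := by
  have hS := P.isRealCoeff_sCoeff
  rw [bracket, bracket, wirtinger_apply, wirtinger_apply, ← Finset.sum_sub_distrib,
    Finset.mul_sum, Finset.sum_mul, Finset.sum_mul]
  refine norm_sum_le_of_le _ fun j _ => ?_
  have h1 := norm_dbPoly_le hc.norm_swap j hz
  have h2 := norm_dbPoly_sub_le hc.norm_swap j hz hz'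
  have h3 : ‖hamField P.generator z' j‖ ≤ weight P.sCoeff j * r ^ 3 := by
    rw [generator, hamField_quarticPoly, norm_mul, norm_neg, Complex.norm_I, one_mul]
    exact norm_dbPoly_le hS.norm_swap j hz'
  have h4 : ‖hamField P.generator z j - hamField P.generator z' j‖ ≤
      weight P.sCoeff j * (3 * r ^ 2 * ‖z - z'‖) := by
    rw [generator, hamField_quarticPoly, hamField_quarticPoly, ← mul_sub, norm_mul, norm_neg,
      Complex.norm_I, one_mul]
    exact norm_dbPoly_sub_le hS.norm_swap j hz hz'
  have h5 : ‖dzPoly c j z‖ ≤ weight c j * r ^ 3 := by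
    rwa [hc.dzPoly_eq, RCLike.norm_conj]
  have h6 : ‖dzPoly c j z - dzPoly c j z'‖ ≤ weight c j * (3 * r ^ 2 * ‖z - z'‖) := by
    rwa [hc.dzPoly_eq, hc.dzPoly_eq, ← map_sub, RCLike.norm_conj]
  have h7 : ‖conj (hamField P.generator z' j)‖ ≤ weight P.sCoeff j * r ^ 3 := by
    rwa [RCLike.norm_conj]
  have h8 : ‖conj (hamField P.generator z j) - conj (hamField P.generator z' j)‖ ≤
      weight P.sCoeff j * (3 * r ^ 2 * ‖z - z'‖) := by
    rwa [← map_sub, RCLike.norm_conj]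
  rw [add_sub_add_comm]
  refine (norm_add_le_of_le (norm_mul_sub_mul_le h5 h3 h6 h4)
    (norm_mul_sub_mul_le h1 h7 h2 h8)).trans (le_of_eq ?_)
  ring

/-- Remainder of the normal form. -/
noncomputable def remainder (w : Phase) : ℂ := P.bnf w - P.h2 w - quarticPoly P.h4Coeff w

/-- Interpolation between the integrable part at `u 0` and the Hamiltonian at `u 1`. -/
noncomputable def interpolation (u : ℝ → Phase) (s : ℝ) : ℂ :=
  P.h2 (u s) + quarticPoly P.h4Coeff (u s) + s * quarticPoly P.gHatCoeff (u s)

theorem weight_sCoeff_le (j : Fin 2) : weight P.sCoeff j ≤ P.Sstar := by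
  fin_cases j
  · exact le_max_left _ _
  · exact le_max_right _ _

theorem Sstar_nonneg : 0 ≤ P.Sstar := (weight_nonneg _ 0).trans (P.weight_sCoeff_le 0)

theorem Rdagger_nonneg : 0 ≤ P.Rdagger :=
  Finset.sum_nonneg fun j _ => mul_nonneg (weight_nonneg _ j)
    (add_nonneg (mul_nonneg zero_le_two (weight_nonneg _ j)) (weight_nonneg _ j))

variable {P}

/-- The quartic terms cancel: the derivative of `H₂` gives `-Ĝ` and that of the factor `s` gives
`Ĝ`. -/
theorem hasDerivWithinAt_interpolation (hω₀ : 0 < P.ω 0) (hω₁ : P.ω 0 < P.ω 1)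
    (hres : P.ω 1 ≠ 3 * P.ω 0) {u : ℝ → Phase} (hu : IsSolutionOn P.generator (Icc 0 1) u)
    {s : ℝ} (hs : s ∈ Icc (0 : ℝ) 1) :
    HasDerivWithinAt (P.interpolation u)
      (P.bracket P.h4Coeff (u s) + s * P.bracket P.gHatCoeff (u s)) (Icc 0 1) s := by
  have d1 := (P.hasFDerivAt_h2 (u s)).comp_hasDerivWithinAt s (hu s hs)
  have d2 := (hasFDerivAt_quarticPoly P.h4Coeff (u s)).comp_hasDerivWithinAt s (hu s hs)
  have d3 := (hasFDerivAt_quarticPoly P.gHatCoeff (u s)).comp_hasDerivWithinAt s (hu s hs)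
  have d4 := (Complex.ofRealCLM.hasDerivAt (x := s)).hasDerivWithinAt (s := Icc 0 1)
  have d := (d1.add d2).add (d4.mul d3)
  have hX : hamField P.generator (u s) = fun j => -Complex.I * dbPoly P.sCoeff j (u s) :=
    funext fun j => hamField_quarticPoly _ _ _
  have hhom := P.homological_equation hω₀ hω₁ hres (u s)
  rw [← hX] at hhom
  rw [hhom] at d
  refine d.congr_deriv ?_
  simp only [bracket, Complex.ofRealCLM_apply, Complex.ofReal_one, Function.comp_apply]
  ring

theorem remainder_eq {u : ℝ → Phase} {w : Phase} (h0 : u 0 = w)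
    (hu : IsSolutionOn P.generator (Icc 0 1) u) :
    P.remainder w = P.interpolation u 1 - P.interpolation u 0 := by
  rw [remainder, bnf, generator, timeOneMap_eq P.isRealCoeff_sCoeff h0 hu, hamiltonian_eq,
    quarticPoly_split, interpolation, interpolation, h0]
  push_cast
  ring

theorem sum_weight_le (P : Params) : (∑ j, weight P.sCoeff j * weight P.h4Coeff j) +
    (∑ j, weight P.sCoeff j * weight P.gHatCoeff j) ≤ P.Rdagger := by
  rw [Rdagger, ← Finset.sum_add_distrib]
  refine Finset.sum_le_sum fun j _ => ?_
  have h1 := weight_nonneg P.sCoeff j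
  have h2 := weight_nonneg P.h4Coeff j
  nlinarith [mul_nonneg h1 h2]

/-- Mean value inequality for the difference of two interpolations. The factor `16` is `12` from the
brackets times `4/3` from the separation of the orbits. -/
theorem norm_remainder_sub_le (hω₀ : 0 < P.ω 0) (hω₁ : P.ω 0 < P.ω 1)
    (hres : P.ω 1 ≠ 3 * P.ω 0) {ρ : ℝ} (hρ : P.Sstar * ρ ^ 2 ≤ 1 / 27) {w w' : Phase}
    (hw : ‖w‖ ≤ ρ) (hw' : ‖w'‖ ≤ ρ) :
    ‖P.remainder w - P.remainder w'‖ ≤ 16 * P.Rdagger * (3 / 2 * ρ) ^ 5 * ‖w - w'‖ := by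
  have hρ0 : 0 ≤ ρ := (norm_nonneg w).trans hw
  have hS := P.Sstar_nonneg
  have hR := P.Rdagger_nonneg
  have hflow : ∀ w : Phase, ‖w‖ ≤ ρ → ∃ u : ℝ → Phase, u 0 = w ∧
      IsSolutionOn P.generator (Icc 0 1) u ∧ ∀ t, ‖u t‖ ≤ 3 / 2 * ρ := by
    intro w hw
    have h : P.Sstar * ‖w‖ ^ 2 ≤ 4 / 27 := by
      calc P.Sstar * ‖w‖ ^ 2 ≤ P.Sstar * ρ ^ 2 := by gcongr
        _ ≤ 4 / 27 := by linarith
    obtain ⟨u, h0, hu, hur⟩ := exists_isSolutionOn P.isRealCoeff_sCoeff P.weight_sCoeff_le h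
    exact ⟨u, h0, hu, fun t => (hur t).trans (by gcongr)⟩
  obtain ⟨u, h0, hu, hur⟩ := hflow w hw
  obtain ⟨v, h0', hv, hvr⟩ := hflow w' hw'
  -- The Grönwall exponent is at most `1/4`, and `exp x ≤ 1 / (1 - x)`.
  have hexp : ∀ t ∈ Icc (0 : ℝ) 1, ‖u t - v t‖ ≤ 4 / 3 * ‖w - w'‖ := by
    intro t ht
    have h := dist_le_of_isSolutionOn P.isRealCoeff_sCoeff P.weight_sCoeff_le hu hv
      (fun t _ => hur t) (fun t _ => hvr t) ht
    rw [h0, h0'] at h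
    have hk : 3 * P.Sstar * (3 / 2 * ρ) ^ 2 * t ≤ 1 / 4 := by
      calc 3 * P.Sstar * (3 / 2 * ρ) ^ 2 * t ≤ 3 * P.Sstar * (3 / 2 * ρ) ^ 2 * 1 := by
            gcongr
            exact ht.2
        _ = 27 / 4 * (P.Sstar * ρ ^ 2) := by ring
        _ ≤ 1 / 4 := by linarith
    have he : Real.exp (3 * P.Sstar * (3 / 2 * ρ) ^ 2 * t) ≤ 4 / 3 := by
      refine (Real.exp_le_exp.2 hk).trans ?_
      have := Real.exp_bound_div_one_sub_of_interval (x := 1 / 4) (by norm_num) (by norm_num)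
      norm_num at this ⊢
      exact this
    calc _ ≤ ‖w - w'‖ * Real.exp (3 * P.Sstar * (3 / 2 * ρ) ^ 2 * t) := h
      _ ≤ ‖w - w'‖ * (4 / 3) := by gcongr
      _ = _ := by ring
  have hmv := norm_image_sub_le_of_norm_deriv_le_segment_01'
    (f := fun s => P.interpolation u s - P.interpolation v s)
    (C := 16 * P.Rdagger * (3 / 2 * ρ) ^ 5 * ‖w - w'‖)
    (fun s hs => (hasDerivWithinAt_interpolation hω₀ hω₁ hres hu hs).sub
      (hasDerivWithinAt_interpolation hω₀ hω₁ hres hv hs)) (fun s hs => ?_)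
  · rw [remainder_eq h0 hu, remainder_eq h0' hv]
    convert! hmv using 2
    ring
  · have hs' := Ico_subset_Icc_self hs
    have h1 := P.norm_bracket_sub_le P.isRealCoeff_h4Coeff (hur s) (hvr s)
    have h2 := P.norm_bracket_sub_le P.isRealCoeff_gHatCoeff (hur s) (hvr s)
    set a := ∑ j, weight P.sCoeff j * weight P.h4Coeff j
    set b := ∑ j, weight P.sCoeff j * weight P.gHatCoeff j
    have hab : a + b ≤ P.Rdagger := P.sum_weight_le
    have hs1 : ‖(s : ℂ)‖ ≤ 1 := by
      rw [Complex.norm_real, Real.norm_eq_abs, abs_of_nonneg hs.1]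
      exact hs.2.le
    have e : ∀ a b c d s : ℂ, a + s * b - (c + s * d) = (a - c) + s * (b - d) := by
      intros; ring
    rw [e]
    refine (norm_add_le _ _).trans ?_
    rw [norm_mul]
    calc _ ≤ 12 * a * (3 / 2 * ρ) ^ 5 * ‖u s - v s‖ +
          1 * (12 * b * (3 / 2 * ρ) ^ 5 * ‖u s - v s‖) := by gcongr
      _ = 12 * (a + b) * (3 / 2 * ρ) ^ 5 * ‖u s - v s‖ := by ring
      _ ≤ 12 * P.Rdagger * (3 / 2 * ρ) ^ 5 * (4 / 3 * ‖w - w'‖) := by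
          gcongr
          exact hexp s hs'
      _ = _ := by ring

/-! ### Regularity of the normal form -/

theorem contDiff_quarticPoly (c : BiIndex → ℂ) {n : WithTop ℕ∞} :
    ContDiff ℝ n (quarticPoly c) := by
  refine ContDiff.sum fun m _ => contDiff_const.mul (contDiff_prod fun i _ => ?_)
  have h1 : ContDiff ℝ n fun z : Phase => z i := contDiff_apply ℝ _ i
  exact (h1.pow _).mul ((Complex.conjCLE.contDiff.comp h1).pow _)

theorem contDiff_h2 (P : Params) {n : WithTop ℕ∞} : ContDiff ℝ n P.h2 := by
  refine ContDiff.sum fun i _ => contDiff_const.mul ?_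
  have h1 : ContDiff ℝ n fun z : Phase => z i := contDiff_apply ℝ _ i
  exact h1.mul (Complex.conjCLE.contDiff.comp h1)

theorem contDiffAt_bnf {w : Phase} (hw : P.Sstar * ‖w‖ ^ 2 < 4 / 27) {n : WithTop ℕ∞}
    (hn : n ≠ 0) : ContDiffAt ℝ n P.bnf w := by
  have h := contDiffAt_timeOneMap P.isRealCoeff_sCoeff P.weight_sCoeff_le hw hn
  have hH : ContDiff ℝ n P.hamiltonian := by
    have e : P.hamiltonian = fun z => P.h2 z + quarticPoly (fun m => (P.gCoeff m : ℂ)) z :=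
      funext P.hamiltonian_eq
    rw [e]
    exact P.contDiff_h2.add (contDiff_quarticPoly _)
  exact hH.contDiffAt.comp w h

/-- The left side is the Wirtinger derivative of the remainder: half the sum of two derivatives in
unit directions, each bounded by the local Lipschitz constant. -/
theorem norm_dzbar_bnf_sub_le (hω₀ : 0 < P.ω 0) (hω₁ : P.ω 0 < P.ω 1)
    (hres : P.ω 1 ≠ 3 * P.ω 0) {ρ : ℝ} (hρ : P.Sstar * ρ ^ 2 ≤ 1 / 27) {w : Phase}
    (hw : ‖w‖ < ρ) (j : Fin 2) :
    ‖dzbar P.bnf w j - (P.ω j + P.hessian.mulVec (fun i => ‖w i‖ ^ 2) j : ℝ) * w j‖ ≤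
      16 * P.Rdagger * (3 / 2 * ρ) ^ 5 := by
  have hρ0 : 0 ≤ ρ := (norm_nonneg w).trans hw.le
  have hR := P.Rdagger_nonneg
  have hS := P.Sstar_nonneg
  have hL : ‖fderiv ℝ P.remainder w‖ ≤ 16 * P.Rdagger * (3 / 2 * ρ) ^ 5 := by
    refine norm_fderiv_le_of_lip' ℝ (by positivity) ?_
    filter_upwards [continuous_norm.continuousAt.eventually (gt_mem_nhds hw)] with x hx
    exact norm_remainder_sub_le hω₀ hω₁ hres hρ hx.le hw.le
  have hsm : P.Sstar * ‖w‖ ^ 2 < 4 / 27 := by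
    calc P.Sstar * ‖w‖ ^ 2 ≤ P.Sstar * ρ ^ 2 := by gcongr
      _ < 4 / 27 := by linarith
  have hb : DifferentiableAt ℝ P.bnf w :=
    (contDiffAt_bnf hsm one_ne_zero).differentiableAt one_ne_zero
  have hf : fderiv ℝ P.remainder w = fderiv ℝ P.bnf w -
      wirtinger (fun j => P.ω j * conj (w j)) (fun j => P.ω j * w j) -
      wirtinger (fun j => dzPoly P.h4Coeff j w) (fun j => dbPoly P.h4Coeff j w) :=
    ((hb.hasFDerivAt.sub (P.hasFDerivAt_h2 w)).sub (hasFDerivAt_quarticPoly _ w)).fderiv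
  have e1 := dzbar_of_hasFDerivAt (P.hasFDerivAt_h2 w) j
  have e2 := dzbar_quarticPoly P.h4Coeff w j
  have e : dzbar P.bnf w j - (P.ω j + P.hessian.mulVec (fun i => ‖w i‖ ^ 2) j : ℝ) * w j =
      dzbar P.remainder w j := by
    rw [dbPoly_h4Coeff] at e2
    have e3 : dzbar P.remainder w j =
        dzbar P.bnf w j - dzbar P.h2 w j - dzbar (quarticPoly P.h4Coeff) w j := by
      unfold dzbar
      rw [hf, (P.hasFDerivAt_h2 w).fderiv, (hasFDerivAt_quarticPoly P.h4Coeff w).fderiv]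
      simp only [sub_apply]
      ring
    rw [e3, e1, e2]
    push_cast
    ring
  rw [e, dzbar]
  have hs : ∀ a : ℂ, ‖a‖ = 1 → ‖fderiv ℝ P.remainder w (Pi.single j a)‖ ≤
      16 * P.Rdagger * (3 / 2 * ρ) ^ 5 := fun a ha => by
    have := (fderiv ℝ P.remainder w).le_opNorm (Pi.single j a)
    rw [Pi.norm_single, ha, mul_one] at this
    exact this.trans hL
  have h1 := hs 1 norm_one
  have h2 := hs Complex.I Complex.norm_I
  rw [norm_mul]
  have h3 := norm_add_le (fderiv ℝ P.remainder w (Pi.single j 1))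
    (Complex.I * fderiv ℝ P.remainder w (Pi.single j Complex.I))
  rw [norm_mul, Complex.norm_I, one_mul] at h3
  have h4 : ‖(1 / 2 : ℂ)‖ = 1 / 2 := by norm_num
  rw [h4]
  linarith

end Params

end MetaBNF

namespace MetaBNF

open ComplexConjugate Set Filter Topology

/-! ### Global solutions of bounded Lipschitz fields -/

section Global

variable {E : Type*} [NormedAddCommGroup E] [NormedSpace ℝ E] [CompleteSpace E]

theorem exists_hasDerivWithinAt_Icc {Y : E → E} {K M : NNReal} (hY : LipschitzWith K Y)
    (hM : ∀ x, ‖Y x‖ ≤ M) (x₀ : E) {T : ℝ} (hT : 0 ≤ T) :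
    ∃ z : ℝ → E, z 0 = x₀ ∧
      ∀ t ∈ Icc (-T) T, HasDerivWithinAt z (Y (z t)) (Icc (-T) T) t := by
  have h0 : (0 : ℝ) ∈ Icc (-T) T := ⟨by linarith, hT⟩
  -- The bounds on `Y` are global, so the ball may have radius `M T` and the time is not restricted.
  have hPL : IsPicardLindelof (fun _ : ℝ => Y) (⟨0, h0⟩ : Icc (-T) T) x₀
      (M * Real.toNNReal T) 0 M K := by
    refine ⟨fun _ _ => hY.lipschitzOnWith, fun _ _ => continuousOn_const, fun _ _ x _ => hM x, ?_⟩
    simp [hT]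
  exact hPL.exists_eq_forall_mem_Icc_hasDerivWithinAt₀

theorem exists_forall_hasDerivAt {Y : E → E} {K M : NNReal} (hY : LipschitzWith K Y)
    (hM : ∀ x, ‖Y x‖ ≤ M) (x₀ : E) :
    ∃ z : ℝ → E, z 0 = x₀ ∧ ∀ t, HasDerivAt z (Y (z t)) t := by
  have hex := fun n : ℕ => exists_hasDerivWithinAt_Icc hY hM x₀ (T := n + 1) (by positivity)
  choose α h0 hα using hex
  have hint : ∀ (n : ℕ) (t : ℝ), t ∈ Ioo (-((n : ℝ) + 1)) (n + 1) →
      HasDerivAt (α n) (Y (α n t)) t := fun n t ht =>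
    (hα n t (Ioo_subset_Icc_self ht)).hasDerivAt (Icc_mem_nhds ht.1 ht.2)
  have hagree : ∀ (n m : ℕ), n ≤ m → EqOn (α n) (α m) (Ioo (-((n : ℝ) + 1)) (n + 1)) := by
    intro n m hnm
    have hnm' : (n : ℝ) ≤ m := Nat.cast_le.2 hnm
    have hn : (0 : ℝ) ≤ n := Nat.cast_nonneg n
    refine ODE_solution_unique_of_mem_Ioo (v := fun _ => Y) (s := fun _ => univ) (K := K)
      (t₀ := 0) (fun _ _ => hY.lipschitzOnWith) ⟨by linarith, by linarith⟩
      (fun t ht => ⟨hint n t ht, trivial⟩)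
      (fun t ht => ⟨hint m t ⟨by linarith [ht.1], by linarith [ht.2]⟩, trivial⟩)
      ((h0 n).trans (h0 m).symm)
  -- The solution with index `⌊|t|⌋₊` lives on an interval whose interior contains `t`, as `|t| <
  -- ⌊|t|⌋₊ + 1`. Near `t` the glued function is the single solution of index `⌊|t|⌋₊ + 1`.
  refine ⟨fun t => α ⌊|t|⌋₊ t, by simp [h0], fun t => ?_⟩
  have hmem : ∀ s : ℝ, s ∈ Ioo (-((⌊|s|⌋₊ : ℝ) + 1)) (⌊|s|⌋₊ + 1) := fun s =>
    abs_lt.1 (Nat.lt_floor_add_one |s|)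
  have heq : ∀ s : ℝ, |s| < |t| + 1 → α ⌊|s|⌋₊ s = α (⌊|t|⌋₊ + 1) s := by
    intro s hs
    refine hagree _ _ ?_ (hmem s)
    rw [← Nat.floor_add_one (abs_nonneg t)]
    exact Nat.floor_mono hs.le
  have hev : (fun s => α ⌊|s|⌋₊ s) =ᶠ[𝓝 t] α (⌊|t|⌋₊ + 1) := by
    filter_upwards [continuous_abs.continuousAt.eventually (gt_mem_nhds (lt_add_one |t|))] with s hs
    exact heq s hs
  have hd := hint (⌊|t|⌋₊ + 1) t (by
    have := hmem t
    push_cast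
    exact ⟨by linarith [this.1], by linarith [this.2]⟩)
  rw [← heq t (lt_add_one _)] at hd
  exact hd.congr_of_eventuallyEq hev

end Global

/-! ### A priori estimates -/

theorem lt_of_bootstrap {g : ℝ → ℝ} {b c : ℝ} (hg : ContinuousOn g (Icc 0 b)) (h0 : g 0 < c)
    (h : ∀ t ∈ Icc 0 b, (∀ s ∈ Icc 0 t, g s ≤ c) → g t < c) : ∀ t ∈ Icc 0 b, g t < c := by
  by_contra! hcon
  obtain ⟨t₁, ht₁, hgt₁⟩ := hcon
  have hcl : IsCompact (Icc 0 b ∩ g ⁻¹' Ici c) :=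
    isCompact_Icc.of_isClosed_subset (hg.preimage_isClosed_of_isClosed isClosed_Icc isClosed_Ici)
      inter_subset_left
  -- At the first time with `g ≥ c`, an earlier excess over `c` would force, by intermediate values,
  -- a still earlier crossing. So `g ≤ c` up to `t₀` and the hypothesis contradicts `g t₀ ≥ c`.
  obtain ⟨t₀, ⟨ht₀, hgt₀⟩, hleast⟩ := hcl.exists_isLeast ⟨t₁, ht₁, hgt₁⟩
  have hsub : Icc 0 t₀ ⊆ Icc 0 b := Icc_subset_Icc_right ht₀.2
  refine absurd (h t₀ ht₀ fun s hs => ?_) (not_lt.2 hgt₀)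
  by_contra! hlt
  obtain ⟨r, hr, hgr⟩ := intermediate_value_Icc hs.1
    (hg.mono (Icc_subset_Icc_right (hs.2.trans ht₀.2))) ⟨h0.le, hlt.le⟩
  have h1 : t₀ ≤ r := hleast ⟨hsub ⟨hr.1, hr.2.trans hs.2⟩, hgr.ge⟩
  have h2 : r = s := le_antisymm hr.2 (hs.2.trans h1)
  rw [h2] at hgr
  exact hlt.ne' hgr

section Apriori

variable {F : Phase → ℂ} {Ω : (Fin 2 → ℝ) → Fin 2 → ℝ} {σ b D r : ℝ} {y : ℝ → Phase}

/-- Actions are almost conserved by a small perturbation of an integrable Hamiltonian with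
frequencies `Ω`. -/
theorem abs_normSq_sub_le (hσ : |σ| = 1)
    (hF : ∀ w : Phase, ‖w‖ ≤ r → ∀ j,
      ‖dzbar F w j - (Ω (fun i => ‖w i‖ ^ 2) j : ℝ) * w j‖ ≤ D)
    (hy : ∀ s ∈ Icc 0 b, HasDerivWithinAt y (σ • hamField F (y s)) (Icc 0 b) s)
    (hr : ∀ s ∈ Icc 0 b, ‖y s‖ ≤ r) {t : ℝ} (ht : t ∈ Icc 0 b) (j : Fin 2) :
    |‖y t j‖ ^ 2 - ‖y 0 j‖ ^ 2| ≤ 2 * (r * D) * t := by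
  have hd : ∀ s ∈ Icc 0 b, HasDerivWithinAt (fun s => ‖y s j‖ ^ 2)
      (2 * inner ℝ (y s j) (σ • hamField F (y s) j)) (Icc 0 b) s := fun s hs =>
    (hasDerivWithinAt_pi.1 (hy s hs) j).norm_sq
  have h := norm_image_sub_le_of_norm_deriv_le_segment' hd (C := 2 * (r * D))
    (fun s hs => ?_) t ht
  · simpa using h
  · have hs' := Ico_subset_Icc_self hs
    set e := dzbar F (y s) j - (Ω (fun i => ‖y s i‖ ^ 2) j : ℝ) * y s j with he
    -- The integrable velocity is a real multiple of `i y_j`, orthogonal to `y_j`; only the error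
    -- `e` changes the action.
    have h1 : inner ℝ (y s j) (σ • hamField F (y s) j) =
        inner ℝ (y s j) (σ • (-Complex.I * e)) := by
      rw [he, hamField]
      simp only [Complex.inner, Complex.real_smul, Complex.mul_re, Complex.mul_im,
        Complex.sub_re, Complex.sub_im, Complex.conj_re, Complex.conj_im, Complex.ofReal_re,
        Complex.ofReal_im, Complex.neg_re, Complex.neg_im, Complex.I_re, Complex.I_im]
      ring
    rw [h1, norm_mul, Real.norm_ofNat]
    have h2 := norm_inner_le_norm (𝕜 := ℝ) (y s j) (σ • (-Complex.I * e))
    rw [norm_smul, Real.norm_eq_abs σ, hσ, one_mul, norm_mul, norm_neg, Complex.norm_I,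
      one_mul] at h2
    have h3 : ‖y s j‖ ≤ r := (norm_le_pi_norm _ j).trans (hr s hs')
    have h4 : ‖e‖ ≤ D := hF _ (hr s hs') j
    have hr0 : 0 ≤ r := (norm_nonneg _).trans h3
    have : ‖y s j‖ * ‖e‖ ≤ r * D := by gcongr
    linarith

/-- Comparison of a perturbed solution with the unperturbed one. -/
theorem norm_sub_exp_le (hσ : |σ| = 1) (hD : 0 ≤ D) {L : ℝ} (hL : 0 ≤ L)
    (hΩ : ∀ (I I' : Fin 2 → ℝ) (j : Fin 2), |Ω I j - Ω I' j| ≤ L * ‖I - I'‖)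
    (hF : ∀ w : Phase, ‖w‖ ≤ r → ∀ j,
      ‖dzbar F w j - (Ω (fun i => ‖w i‖ ^ 2) j : ℝ) * w j‖ ≤ D)
    (hy : ∀ s ∈ Icc 0 b, HasDerivWithinAt y (σ • hamField F (y s)) (Icc 0 b) s)
    (hr : ∀ s ∈ Icc 0 b, ‖y s‖ ≤ r) (hb : 0 ≤ b) (j : Fin 2) :
    ‖y b j - y 0 j * Complex.exp (-Complex.I * ((Ω (fun i => ‖y 0 i‖ ^ 2) j * (σ * b) : ℝ) : ℂ))‖ ≤
      (L * (2 * (r * D) * b) * r + D) * b := by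
  set κ : ℝ := Ω (fun i => ‖y 0 i‖ ^ 2) j with hκ
  have hr0 : 0 ≤ r := (norm_nonneg _).trans (hr 0 ⟨le_rfl, hb⟩)
  have hphase : ∀ s : ℝ, HasDerivAt (fun s : ℝ => Complex.exp (Complex.I * κ * σ * s))
      (Complex.exp (Complex.I * κ * σ * s) * (Complex.I * κ * σ)) s := fun s => by
    have h := ((Complex.ofRealCLM.hasDerivAt (x := s)).const_mul (Complex.I * κ * σ)).cexp
    simpa using h
  have hnorm : ∀ s : ℝ, ‖Complex.exp (Complex.I * κ * σ * s)‖ = 1 := fun s => by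
    rw [show Complex.I * κ * σ * s = ((κ * σ * s : ℝ) : ℂ) * Complex.I by push_cast; ring,
      Complex.norm_exp_ofReal_mul_I]
  -- Rotating frame with the frequency `κ` frozen at the initial actions: the velocity left is
  -- detuning times `y_j` plus the error `e`.
  have hd : ∀ s ∈ Icc 0 b, HasDerivWithinAt
      (fun s => y s j * Complex.exp (Complex.I * κ * σ * s))
      ((σ • hamField F (y s)) j * Complex.exp (Complex.I * κ * σ * s) +
        y s j * (Complex.exp (Complex.I * κ * σ * s) * (Complex.I * κ * σ))) (Icc 0 b) s :=
    fun s hs => (hasDerivWithinAt_pi.1 (hy s hs) j).mul (hphase s).hasDerivWithinAt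
  have h := norm_image_sub_le_of_norm_deriv_le_segment' hd
    (C := L * (2 * (r * D) * b) * r + D) (fun s hs => ?_) b ⟨hb, le_rfl⟩
  · have hexp : Complex.exp (-Complex.I * ((κ * (σ * b) : ℝ) : ℂ)) *
        Complex.exp (Complex.I * κ * σ * b) = 1 := by
      rw [← Complex.exp_add, ← Complex.exp_zero]
      congr 1
      push_cast
      ring
    have e : y b j * Complex.exp (Complex.I * κ * σ * b) -
        y 0 j * Complex.exp (Complex.I * κ * σ * (0 : ℝ)) =
        (y b j - y 0 j * Complex.exp (-Complex.I * ((κ * (σ * b) : ℝ) : ℂ))) *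
          Complex.exp (Complex.I * κ * σ * b) := by
      rw [sub_mul, mul_assoc (y 0 j), hexp]
      simp
    rw [e, norm_mul, hnorm, mul_one, sub_zero] at h
    exact h
  · have hs' := Ico_subset_Icc_self hs
    set e := dzbar F (y s) j - (Ω (fun i => ‖y s i‖ ^ 2) j : ℝ) * y s j with he
    have h1 : (σ • hamField F (y s)) j * Complex.exp (Complex.I * κ * σ * s) +
        y s j * (Complex.exp (Complex.I * κ * σ * s) * (Complex.I * κ * σ)) =
        -Complex.I * σ * (((Ω (fun i => ‖y s i‖ ^ 2) j - κ : ℝ) : ℂ) * y s j + e) *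
          Complex.exp (Complex.I * κ * σ * s) := by
      rw [he, Pi.smul_apply, hamField, Complex.real_smul]
      push_cast
      ring
    have hact : ‖(fun i => ‖y s i‖ ^ 2) - fun i => ‖y 0 i‖ ^ 2‖ ≤ 2 * (r * D) * b := by
      refine (pi_norm_le_iff_of_nonneg (by positivity)).2 fun i => ?_
      refine (abs_normSq_sub_le hσ hF hy hr hs' i).trans ?_
      gcongr
      exact hs'.2
    have h2 : |Ω (fun i => ‖y s i‖ ^ 2) j - κ| ≤ L * (2 * (r * D) * b) :=
      (hΩ _ _ j).trans (by gcongr)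
    have h3 : ‖y s j‖ ≤ r := (norm_le_pi_norm _ j).trans (hr s hs')
    have h4 : ‖e‖ ≤ D := hF _ (hr s hs') j
    rw [h1, norm_mul, hnorm, mul_one, norm_mul, norm_mul, norm_neg, Complex.norm_I, one_mul,
      Complex.norm_real, Real.norm_eq_abs, hσ, one_mul]
    refine (norm_add_le _ _).trans ?_
    rw [norm_mul, Complex.norm_real, Real.norm_eq_abs]
    gcongr

/-- Solutions do not leave the ball `‖w‖ ≤ r` as long as the total variation of the actions due to
the perturbation is small. -/
theorem norm_lt_of_apriori (hσ : |σ| = 1) (hD : 0 ≤ D)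
    (hF : ∀ w : Phase, ‖w‖ ≤ r → ∀ j,
      ‖dzbar F w j - (Ω (fun i => ‖w i‖ ^ 2) j : ℝ) * w j‖ ≤ D)
    (hcont : ContinuousOn y (Icc 0 b))
    (hy : ∀ s ∈ Icc 0 b, ‖y s‖ ≤ r →
      HasDerivWithinAt y (σ • hamField F (y s)) (Icc 0 b) s)
    (hr : 0 < r) (hsmall : ‖y 0‖ ^ 2 + 2 * (r * D) * b < r ^ 2) :
    ∀ t ∈ Icc 0 b, ‖y t‖ < r := by
  intro t ht
  have hb : 0 ≤ b := ht.1.trans ht.2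
  have h0 : ‖y 0‖ < r := by
    refine lt_of_pow_lt_pow_left₀ 2 hr.le ?_
    have : 0 ≤ 2 * (r * D) * b := by positivity
    linarith
  refine lt_of_bootstrap (g := fun t => ‖y t‖) hcont.norm h0 (fun t ht hle => ?_) t ht
  have hsub : Icc 0 t ⊆ Icc 0 b := Icc_subset_Icc_right ht.2
  refine (pi_norm_lt_iff hr).2 fun j => ?_
  -- The bootstrap bound on `[0, t]` is what makes the equation available there, since it is assumed
  -- only inside the ball. This also covers orbits of a modified field.
  have h := abs_normSq_sub_le hσ hF (b := t)
    (fun s hs => (hy s (hsub hs) (hle s hs)).mono hsub) hle ⟨ht.1, le_rfl⟩ j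
  refine lt_of_pow_lt_pow_left₀ 2 hr.le ?_
  have h1 := (abs_le.1 h).2
  have h2 : ‖y 0 j‖ ^ 2 ≤ ‖y 0‖ ^ 2 := by
    gcongr
    exact norm_le_pi_norm _ j
  have h3 : 2 * (r * D) * t ≤ 2 * (r * D) * b := by
    gcongr
    exact ht.2
  linarith

end Apriori

end MetaBNF

/-! ### Cut-off of the field and the numerical constants. -/

namespace MetaBNF

open ComplexConjugate Set Filter Topology

/-- The Hamiltonian field of a `C²` function on a ball can be extended from a smaller ball to a
bounded Lipschitz field. -/
theorem exists_lipschitz_extension {F : Phase → ℂ} {r R : ℝ} (hr : 0 < r) (hrR : r < R)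
    (hF : ∀ w : Phase, ‖w‖ < R → ContDiffAt ℝ 2 F w) :
    ∃ (Y : Phase → Phase) (K M : NNReal), LipschitzWith K Y ∧ (∀ w, ‖Y w‖ ≤ M) ∧
      ∀ w, ‖w‖ ≤ r → Y w = hamField F w := by
  obtain ⟨r', hr', hr'R⟩ := exists_between hrR
  -- The bump vanishes from radius `r' < R` on, so the product is smooth even where `F` is not
  -- controlled.
  let χ : ContDiffBump (0 : Phase) := ⟨r, r', hr, hr'⟩
  have hfield : ∀ w : Phase, ‖w‖ < R → ContDiffAt ℝ 1 (hamField F) w := fun w hw => by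
    have hd : ContDiffAt ℝ 1 (fderiv ℝ F) w := (hF w hw).fderiv_right (by norm_num)
    refine contDiffAt_pi.2 fun j => contDiffAt_const.mul (contDiffAt_const.mul ?_)
    exact (hd.clm_apply contDiffAt_const).add
      (contDiffAt_const.mul (hd.clm_apply contDiffAt_const))
  have hsmooth : ContDiff ℝ 1 fun w => χ w • hamField F w := by
    refine contDiff_iff_contDiffAt.2 fun w => ?_
    rcases lt_or_ge ‖w‖ R with hw | hw
    · exact χ.contDiffAt.smul (hfield w hw)
    · refine (contDiffAt_const (c := (0 : Phase))).congr_of_eventuallyEq ?_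
      filter_upwards [continuous_norm.continuousAt.eventually
        (lt_mem_nhds (hr'R.trans_le hw))] with x hx
      rw [χ.zero_of_le_dist (by simpa using hx.le), zero_smul]
  have hsupp : HasCompactSupport fun w => χ w • hamField F w :=
    χ.hasCompactSupport.smul_right
  obtain ⟨K, hK⟩ := hsmooth.lipschitzWith_of_hasCompactSupport hsupp one_ne_zero
  obtain ⟨M, hM⟩ := hsupp.exists_bound_of_continuous hsmooth.continuous
  refine ⟨_, K, Real.toNNReal M, hK, fun w => (hM w).trans (Real.le_coe_toNNReal M),
    fun w hw => ?_⟩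
  rw [χ.one_of_mem_closedBall (mem_closedBall_zero_iff.2 hw), one_smul]

namespace Params

variable {P : Params}

theorem Sstar_mul_sq_le {ε : ℝ} (hε : 0 ≤ ε) (h : ENNReal.ofReal ε ≤ P.threshold) :
    P.Sstar * ε ^ 2 ≤ 4 / 243 := by
  rcases P.Sstar_nonneg.eq_or_lt with hS | hS
  · rw [← hS]; norm_num
  have hpos : 0 < 9 * √(3 * P.Sstar) := by positivity
  have h2 : (2 : ENNReal) = ENNReal.ofReal 2 := by simp
  rw [threshold, h2, ← ENNReal.ofReal_div_of_pos hpos,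
    ENNReal.ofReal_le_ofReal_iff (by positivity), le_div_iff₀ hpos] at h
  have hsq : √(3 * P.Sstar) ^ 2 = 3 * P.Sstar := Real.sq_sqrt (by positivity)
  have h4 : (ε * (9 * √(3 * P.Sstar))) ^ 2 ≤ 2 ^ 2 := by gcongr
  rw [mul_pow, mul_pow, hsq] at h4
  linarith

theorem Rstar_nonneg (P : Params) : 0 ≤ P.Rstar :=
  mul_nonneg (by norm_num) P.Rdagger_nonneg

/-- In product form the constraint also makes sense for `R_* = 0`, where it is trivial. -/
theorem Rstar_mul_le_of_mem_timeWindow {ξ ε t : ℝ} (hε : 0 < ε) (ht : t ∈ P.timeWindow ξ ε) :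
    P.Rstar * ε ^ 4 * |t| ≤ 3 / 2 * ξ ^ 2 := by
  rcases P.Rstar_nonneg.eq_or_lt with hR | hR
  · rw [← hR]
    have := sq_nonneg ξ
    linarith
  have hε4 : 0 < ε ^ 4 := by positivity
  have ht' : ENNReal.ofReal |t| ≤ P.tStar ξ / ENNReal.ofReal (ε ^ 4) := ht
  rw [tStar, ← ENNReal.ofReal_div_of_pos (by positivity), ← ENNReal.ofReal_div_of_pos hε4,
    ENNReal.ofReal_le_ofReal_iff (by positivity), le_div_iff₀ hε4, le_div_iff₀ (by positivity)]
    at ht'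
  linarith

theorem abs_hessian_mulVec_sub_le (P : Params) (I I' : Fin 2 → ℝ) (j : Fin 2) :
    |(P.ω j + P.hessian.mulVec I j) - (P.ω j + P.hessian.mulVec I' j)| ≤
      P.hessianNorm * ‖I - I'‖ := by
  rw [add_sub_add_left_eq_sub, ← Pi.sub_apply, ← Matrix.mulVec_sub]
  exact (norm_le_pi_norm _ j).trans (P.norm_hessian_mulVec_le _)

/-- With `ρ = 3/2 ε` the condition `1/27` is exactly met by `4/243`, and `16 (9/4)⁵ = (9/2)⁶ / 9`,
so `1/5` leaves room. -/
theorem norm_dzbar_bnf_sub_le_Rstar (hω₀ : 0 < P.ω 0) (hω₁ : P.ω 0 < P.ω 1)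
    (hres : P.ω 1 ≠ 3 * P.ω 0) {ε : ℝ} (hε : 0 < ε) (hS : P.Sstar * ε ^ 2 ≤ 4 / 243)
    (w : Phase) (hw : ‖w‖ ≤ 7 / 5 * ε) (j : Fin 2) :
    ‖dzbar P.bnf w j - (P.ω j + P.hessian.mulVec (fun i => ‖w i‖ ^ 2) j : ℝ) * w j‖ ≤
      P.Rstar * ε ^ 5 / 5 := by
  have h := norm_dzbar_bnf_sub_le hω₀ hω₁ hres (ρ := 3 / 2 * ε)
    (by rw [mul_pow]; linarith) (hw.trans_lt (by linarith)) j
  refine h.trans ?_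
  rw [Rstar]
  have := mul_nonneg P.Rdagger_nonneg (pow_nonneg hε.le 5)
  ring_nf at this ⊢
  linarith

/-- A priori estimate for a solution of the normal form equations, followed forward (`σ = 1`) or
backward (`σ = -1`) in time. -/
theorem norm_lt_of_bnf (hω₀ : 0 < P.ω 0) (hω₁ : P.ω 0 < P.ω 1)
    (hres : P.ω 1 ≠ 3 * P.ω 0) {ε ξ σ b : ℝ} {y : ℝ → Phase} (hε : 0 < ε)
    (hS : P.Sstar * ε ^ 2 ≤ 4 / 243) (hξ₀ : 0 < ξ) (hξ : ξ ≤ 1 / 2) (hσ : |σ| = 1)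
    (hb : P.Rstar * ε ^ 4 * b ≤ 3 / 2 * ξ ^ 2) (hy0 : ‖y 0‖ = ε)
    (hcont : ContinuousOn y (Icc 0 b))
    (hy : ∀ s ∈ Icc 0 b, ‖y s‖ ≤ 7 / 5 * ε →
      HasDerivWithinAt y (σ • hamField P.bnf (y s)) (Icc 0 b) s) :
    ∀ t ∈ Icc 0 b, ‖y t‖ < 7 / 5 * ε := by
  have hR := P.Rstar_nonneg
  refine norm_lt_of_apriori (Ω := fun I j => P.ω j + P.hessian.mulVec I j) hσ
    (D := P.Rstar * ε ^ 5 / 5) (by positivity)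
    (norm_dzbar_bnf_sub_le_Rstar hω₀ hω₁ hres hε hS) hcont hy (by positivity) ?_
  -- From `ξ ≤ 1/2`. Squared norms then stay below `1.21 ε²`, against `(7/5)² = 1.96`.
  have h1 : P.Rstar * ε ^ 4 * b ≤ 3 / 8 := by nlinarith
  rw [hy0]
  calc ε ^ 2 + 2 * (7 / 5 * ε * (P.Rstar * ε ^ 5 / 5)) * b
      = ε ^ 2 * (1 + 14 / 25 * (P.Rstar * ε ^ 4 * b)) := by ring
    _ ≤ ε ^ 2 * (1 + 14 / 25 * (3 / 8)) := by gcongr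
    _ < (7 / 5 * ε) ^ 2 := by nlinarith [sq_pos_of_pos hε]

theorem exists_sign (t : ℝ) : ∃ σ : ℝ, |σ| = 1 ∧ σ * |t| = t := by
  rcases le_total 0 t with h | h
  · exact ⟨1, by simp, by simp [abs_of_nonneg h]⟩
  · exact ⟨-1, by simp, by simp [abs_of_nonpos h]⟩

theorem mul_mem_uIcc_of_sign {σ t s : ℝ} (hσ : |σ| = 1) (ht : σ * |t| = t)
    (hs : s ∈ Icc 0 |t|) : σ * s ∈ uIcc 0 t := by
  rcases eq_or_eq_neg_of_abs_eq hσ with rfl | rfl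
  · rw [one_mul] at ht ⊢
    rw [ht] at hs
    exact Icc_subset_uIcc hs
  · rw [mem_uIcc]
    right
    constructor <;> linarith [hs.1, hs.2]

end Params

end MetaBNF

/-! ### Existence on the time window and the error of the two-timescale approximation. -/

open MetaBNF MetaBNF.Params Set in
theorem proposition5p3
    -- mass matrix (symmetric positive definite) and diagonal positive definite stiffness matrix
    (M : Matrix (Fin 2) (Fin 2) ℝ) (hM : M.PosDef)
    (k : Fin 2 → ℝ) (hk : ∀ i, 0 < k i)
    -- linear frequencies, modal matrix and cubic coefficients
    (P : MetaBNF.Params)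
    (hΦM : P.Φ.transpose * M * P.Φ = 1)
    (hΦK : P.Φ.transpose * Matrix.diagonal k * P.Φ = Matrix.diagonal fun j => P.ω j ^ 2)
    (hω₀ : 0 < P.ω 0) (hω₁ : P.ω 0 < P.ω 1) (hres : P.ω 1 ≠ 3 * P.ω 0)
    -- initial datum
    (z₀ : MetaBNF.Phase) (ε ξ : ℝ) (hε : ε = ‖z₀‖) (hε₀ : 0 < ε) (hξ₀ : 0 < ξ)
    (hξ : 2 * ξ * ε = min ‖z₀ 0‖ ‖z₀ 1‖)
    (hsmall : ENNReal.ofReal ε ≤ P.threshold) :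
    -- the normal form Hamiltonian is well defined and differentiable for `‖w‖ < 3 ε`
    (∀ w : MetaBNF.Phase, ‖w‖ < 3 * ε →
      w ∈ MetaBNF.flowDomain P.generator ∧ DifferentiableAt ℝ P.bnf w) ∧
    -- the solution exists on the whole time window
    (∃ z : ℝ → MetaBNF.Phase, z 0 = z₀ ∧
      MetaBNF.IsSolutionOn P.bnf (P.timeWindow ξ ε) z) ∧
    ∃ z1 z3 : ℝ → ℝ → MetaBNF.Phase,
      (∀ T₀ T₂ : ℝ, ∀ j : Fin 2, z1 T₀ T₂ j = (ε : ℂ)⁻¹ * z₀ j *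
        Complex.exp (-Complex.I * ((P.ω j * T₀ +
          P.hessian.mulVec (fun i => ‖z₀ i‖ ^ 2 / ε ^ 2) j * T₂ : ℝ) : ℂ))) ∧
      (∀ T₀ T₂ : ℝ, z3 T₀ T₂ = 0) ∧
      -- every solution, on any interval of times contained in the window
      ∀ J : Set ℝ, J.OrdConnected → 0 ∈ J → J ⊆ P.timeWindow ξ ε →
        ∀ z : ℝ → MetaBNF.Phase, z 0 = z₀ → MetaBNF.IsSolutionOn P.bnf J z →
          ∃ ztilde : ℝ → MetaBNF.Phase, ∀ t ∈ J,
            z t = ε • z1 t (ε ^ 2 * t) + ε ^ 3 • z3 t (ε ^ 2 * t) + ε ^ 5 • ztilde t ∧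
            ‖z t‖ ≤ 7 / (2 * √2) * ε ∧
            ‖ztilde t‖ ≤ (ε ^ 2 * P.hessianNorm * |t| + ξ⁻¹) * P.Rstar * |t| := by
  have hS : P.Sstar * ε ^ 2 ≤ 4 / 243 := Sstar_mul_sq_le hε₀.le hsmall
  have hS0 := P.Sstar_nonneg
  have hR0 := P.Rstar_nonneg
  have hξ2 : ξ ≤ 1 / 2 := by
    have h : 2 * ξ * ε ≤ ε := by
      rw [hξ]
      exact (min_le_left _ _).trans ((norm_le_pi_norm z₀ 0).trans hε.ge)
    nlinarith
  have hsub : ∀ w : Phase, ‖w‖ < 3 * ε → P.Sstar * ‖w‖ ^ 2 < 4 / 27 := by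
    intro w hw
    rcases hS0.eq_or_lt with h | h
    · rw [← h]; norm_num
    · calc P.Sstar * ‖w‖ ^ 2 < P.Sstar * (3 * ε) ^ 2 := by gcongr
        _ = 9 * (P.Sstar * ε ^ 2) := by ring
        _ ≤ 4 / 27 := by linarith
  refine ⟨fun w hw => ⟨?_, (contDiffAt_bnf (hsub w hw) one_ne_zero).differentiableAt one_ne_zero⟩,
    ?_, ?_⟩
  · obtain ⟨u, h0, hu, -⟩ := exists_isSolutionOn P.isRealCoeff_sCoeff P.weight_sCoeff_le
      (hsub w hw).le
    exact ⟨u, h0, hu⟩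
  · obtain ⟨Y, K, N, hK, hN, hY⟩ := exists_lipschitz_extension (F := P.bnf) (r := 7 / 5 * ε)
      (R := 3 * ε) (by positivity) (by linarith) fun w hw =>
        contDiffAt_bnf (hsub w hw) two_ne_zero
    -- A solution on all of `ℝ` also serves the infinite window. The a priori bound keeps it, at
    -- times of the window, where `Y` is the original field.
    obtain ⟨z, hz0, hz⟩ := exists_forall_hasDerivAt hK hN z₀
    refine ⟨z, hz0, fun t ht => ?_⟩
    obtain ⟨σ, hσ, hσt⟩ := exists_sign t
    have hd : ∀ s : ℝ, HasDerivAt (fun s => z (σ * s)) (σ • Y (z (σ * s))) s := fun s => by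
      have h := (hz (σ * s)).scomp s ((hasDerivAt_id s).const_mul σ)
      rw [mul_one] at h
      exact h
    have hlt := norm_lt_of_bnf hω₀ hω₁ hres (y := fun s => z (σ * s)) hε₀ hS hξ₀ hξ2 hσ
      (Rstar_mul_le_of_mem_timeWindow hε₀ ht) (by simp [hz0, hε])
      (fun s _ => (hd s).continuousAt.continuousWithinAt)
      (fun s _ hs => by rw [← hY _ hs]; exact (hd s).hasDerivWithinAt) |t|
      ⟨abs_nonneg t, le_rfl⟩
    simp only [hσt] at hlt
    rw [← hY _ hlt.le]
    exact (hz t).hasDerivWithinAt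
  · refine ⟨fun T₀ T₂ j => (ε : ℂ)⁻¹ * z₀ j * Complex.exp (-Complex.I * ((P.ω j * T₀ +
      P.hessian.mulVec (fun i => ‖z₀ i‖ ^ 2 / ε ^ 2) j * T₂ : ℝ) : ℂ)), fun _ _ => 0,
      fun _ _ _ => rfl, fun _ _ => rfl, fun J hJ h0J hJw z hz0 hz => ?_⟩
    -- The corrector is defined by the expansion itself; only its bound has content.
    refine ⟨fun t => (ε ^ 5)⁻¹ • (z t - ε • fun j => (ε : ℂ)⁻¹ * z₀ j *
      Complex.exp (-Complex.I * ((P.ω j * t + P.hessian.mulVec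
        (fun i => ‖z₀ i‖ ^ 2 / ε ^ 2) j * (ε ^ 2 * t) : ℝ) : ℂ))), fun t ht => ?_⟩
    obtain ⟨σ, hσ, hσt⟩ := exists_sign t
    have hmaps : MapsTo (fun s => σ * s) (Icc 0 |t|) J := fun s hs =>
      hJ.uIcc_subset h0J ht (mul_mem_uIcc_of_sign hσ hσt hs)
    have hd : ∀ s ∈ Icc 0 |t|, HasDerivWithinAt (fun s => z (σ * s))
        (σ • hamField P.bnf (z (σ * s))) (Icc 0 |t|) s := fun s hs => by
      have h := (hz (σ * s) (hmaps hs)).scomp s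
        ((hasDerivAt_id s).const_mul σ).hasDerivWithinAt hmaps
      rw [mul_one] at h
      exact h
    have hlt := norm_lt_of_bnf hω₀ hω₁ hres (y := fun s => z (σ * s)) hε₀ hS hξ₀ hξ2 hσ
      (Rstar_mul_le_of_mem_timeWindow hε₀ (hJw ht)) (by simp [hz0, hε])
      (fun s hs => (hd s hs).continuousWithinAt) (fun s hs _ => hd s hs)
    have hcmp := norm_sub_exp_le (Ω := fun I j => P.ω j + P.hessian.mulVec I j) hσ
      (D := P.Rstar * ε ^ 5 / 5) (by positivity) (L := P.hessianNorm) (norm_nonneg _)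
      P.abs_hessian_mulVec_sub_le (norm_dzbar_bnf_sub_le_Rstar hω₀ hω₁ hres hε₀ hS) hd
      (fun s hs => (hlt s hs).le) (abs_nonneg t)
    have hzt := hlt |t| ⟨abs_nonneg t, le_rfl⟩
    simp only [hσt, mul_zero, hz0] at hcmp hzt
    refine ⟨?_, ?_, ?_⟩
    · rw [smul_zero, add_zero, smul_inv_smul₀ (by positivity), add_sub_cancel]
    · refine hzt.le.trans ?_
      gcongr
      have : √2 ≤ 3 / 2 := by
        rw [Real.sqrt_le_left (by norm_num)]
        norm_num
      linarith
    · have hHn : 0 ≤ P.hessianNorm := norm_nonneg _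
      have hξi : 1 / 5 ≤ ξ⁻¹ := by
        rw [le_inv_comm₀ (by norm_num) hξ₀]
        linarith
      rw [norm_smul, norm_inv, norm_pow, Real.norm_of_nonneg hε₀.le,
        inv_mul_le_iff₀ (by positivity)]
      refine (pi_norm_le_iff_of_nonneg (by positivity)).2 fun j => ?_
      -- The rescalings of actions and slow time cancel, so the phase is that of the integrable
      -- motion.
      have hA : P.hessian.mulVec (fun i => ‖z₀ i‖ ^ 2 / ε ^ 2) j * (ε ^ 2 * t) =
          P.hessian.mulVec (fun i => ‖z₀ i‖ ^ 2) j * t := by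
        have : (fun i => ‖z₀ i‖ ^ 2 / ε ^ 2) = (ε ^ 2)⁻¹ • fun i => ‖z₀ i‖ ^ 2 := by
          funext i
          simp [div_eq_inv_mul]
        rw [this, Matrix.mulVec_smul, Pi.smul_apply, smul_eq_mul]
        field_simp
      have hεc : (ε : ℂ) ≠ 0 := by exact_mod_cast hε₀.ne'
      have e : (z t - ε • fun j => (ε : ℂ)⁻¹ * z₀ j * Complex.exp (-Complex.I * ((P.ω j * t +
          P.hessian.mulVec (fun i => ‖z₀ i‖ ^ 2 / ε ^ 2) j * (ε ^ 2 * t) : ℝ) : ℂ))) j =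
          z t j - z₀ j * Complex.exp (-Complex.I *
            (((P.ω j + P.hessian.mulVec (fun i => ‖z₀ i‖ ^ 2) j) * t : ℝ) : ℂ)) := by
        rw [Pi.sub_apply, Pi.smul_apply, Complex.real_smul, ← mul_assoc, ← mul_assoc,
          mul_inv_cancel₀ hεc, one_mul, hA, add_mul]
      rw [e]
      refine (hcmp j).trans ?_
      have h1 : 0 ≤ P.hessianNorm * P.Rstar * ε ^ 7 * |t| ^ 2 := by positivity
      have h2 : 0 ≤ P.Rstar * ε ^ 5 * |t| := by positivity
      have h3 := mul_le_mul_of_nonneg_right hξi h2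
      -- With `r = 7/5 ε` and `D = R_* ε⁵ / 5`, the quadratic coefficient is `2 (7/5)² / 5 =
      -- 98/125`.
      calc _ = 98 / 125 * (P.hessianNorm * P.Rstar * ε ^ 7 * |t| ^ 2) +
            1 / 5 * (P.Rstar * ε ^ 5 * |t|) := by ring
        _ ≤ P.hessianNorm * P.Rstar * ε ^ 7 * |t| ^ 2 + ξ⁻¹ * (P.Rstar * ε ^ 5 * |t|) := by
            linarith
        _ = _ := by ring
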